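/- **Definitions.** *Groups.* A *string group generated by involutions* (sggi) of rank $n\ge 0$ is a group $G$ together with an ordered list $g_0,\dots,g_{n-1}$ of elements of order exactly $2$ (not necessarily distinct) that generate $G$ and satisfy $(g_jg_k)^2=1$ whenever $|j-k|>1$. It is a *string C-group* if moreover $$\langle g_k : k\in I\rangle\cap\langle g_k : k\in J\rangle=\langle g_k : k\in I\cap J\rangle\qquad\text{for all } I,J\subseteq\{0,\dots,n-1\}.$$ An sggi $G'=\langle g_0',\dots,g_{n-1}'\rangle$ *covers* an sggi $G=\langle g_0,\dots,g_{n-1}\rangle$ of the same rank if there is a surjective homomorphism $G'\to G$ with $g_i'\mapsto g_i$ for all $i$. *Polytopes.* An *abstract $n$-polytope* ($n\ge -1$) is a partially ordered set $\mathcal P$, whose elements are called faces, with the following properties. (A) It has a least and a greatest face and a strictly monotone rank function with values in $\{-1,0,\dots,n\}$, where the least face has rank $-1$, the greatest face has rank $n$, and the rank increases by exactly $1$ when passing from a face to one that covers it in the partial order (so every maximal chain, or *flag*, has exactly one face of each rank $-1,0,\dots,n$). (B) Whenever $F<G$ have ranks $j-1$ and $j+1$, there are exactly two faces $H$ with $F<H<G$.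 (C) For all $F\le G$, the section $G/F=\{H: F\le H\le G\}$ is flag-connected: any two of its flags are joined by a finite sequence of flags of $G/F$ in which consecutive flags differ in exactly one face. Two flags are *$j$-adjacent* if they differ in exactly their faces of rank $j$. A face of rank $k$ is called a $k$-face, and a $k$-face $G$ is regarded as the poset $\{H : H\le G\}$. Isomorphisms are isomorphisms of posets. $\mathcal P$ is *regular* if its automorphism group is transitive on its flags. An $n$-polytope $\mathcal R$ *covers* an $n$-polytope $\mathcal Q$ if there is an order-preserving and rank-preserving map $\mathcal R\to\mathcal Q$ that takes any two $j$-adjacent flags of $\mathcal R$ to two $j$-adjacent flags of $\mathcal Q$, for every $j$. **Theorem 3.3.** (a) Every finite sggi is covered by a finite string C-group of the same rank. (b) Every finite abstract $n$-polytope $\mathcal Q$ is covered by a finite regular $n$-polytope $\mathcal R$. If, for some $k$, all $k$-faces of $\mathcal Q$ are isomorphic to one regular $k$-polytope $\mathcal K$, then $\mathcal R$ can be chosen such that, in addition, all its $k$-faces are isomorphic to $\mathcal K$. -/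

import Mathlib

universe u v

/-! ### String groups generated by involutions and string C-groups -/

/-- `G` together with the ordered family `g₀, …, gₙ₋₁` is a string group generated by involutions
(sggi) of rank `n`: the `gᵢ` are involutions (elements of order exactly two), they generate `G`,
and `(gⱼ gₖ)² = 1` whenever `|j - k| > 1`. Coincidences among the `gᵢ` are allowed. -/
structure IsSggi {G : Type u} [Group G] {n : ℕ} (g : Fin n → G) : Prop where
  closure_eq_top : Subgroup.closure (Set.range g) = ⊤
  orderOf_eq_two : ∀ i, orderOf (g i) = 2
  mul_sq_eq_one : ∀ j k : Fin n, (j : ℕ) + 1 < k → (g j * g k) ^ 2 = 1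

/-- An sggi is a string C-group if it satisfies the intersection condition
`⟨gₖ : k ∈ I⟩ ∩ ⟨gₖ : k ∈ J⟩ = ⟨gₖ : k ∈ I ∩ J⟩` for all sets `I`, `J` of indices. -/
structure IsStringCGroup {G : Type u} [Group G] {n : ℕ} (g : Fin n → G) : Prop
    extends IsSggi g where
  inter_eq : ∀ I J : Set (Fin n),
    Subgroup.closure (g '' I) ⊓ Subgroup.closure (g '' J) = Subgroup.closure (g '' (I ∩ J))

/-- The group `H` with generators `hᵢ` covers the group `G` with generators `gᵢ`: there is an
epimorphism from `H` onto `G` that maps the specified generators to the specified generators,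
in order. -/
def SggiCovers {H : Type u} [Group H] {G : Type v} [Group G] {n : ℕ}
    (h : Fin n → H) (g : Fin n → G) : Prop :=
  ∃ φ : H →* G, Function.Surjective φ ∧ ∀ i, φ (h i) = g i

/-! ### Flags and adjacency

A flag is a maximal chain, which is Mathlib's `Flag`. -/

/-- With respect to a rank function `r`, two flags are `j`-adjacent if they are different, but
contain the same elements of each rank other than `j`. -/
def FlagAdjAt {α : Type u} [PartialOrder α] (r : α → ℤ) (j : ℤ) (Φ Ψ : Flag α) : Prop :=
  Φ ≠ Ψ ∧ ∀ a : α, r a ≠ j → (a ∈ Φ ↔ a ∈ Ψ)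

/-- The flag graph: two flags are joined if they differ in just the element of one rank. -/
def flagGraph {α : Type u} [PartialOrder α] (r : α → ℤ) : SimpleGraph (Flag α) where
  Adj Φ Ψ := ∃ j, FlagAdjAt r j Φ Ψ
  symm := ⟨fun _ _ ⟨j, hne, h⟩ => ⟨j, hne.symm, fun a ha => (h a ha).symm⟩⟩
  loopless := ⟨fun _ ⟨_, hne, _⟩ => hne rfl⟩

/-! ### Abstract polytopes -/

/-- An abstract polytope of rank `n` (an abstract `n`-polytope). The rank `n` is an integer; the
axioms force `n ≥ -1`, and the polytope of rank `-1` has just one face. -/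
structure AbstractPolytope (n : ℤ) where
  /-- The faces. -/
  Face : Type u
  /-- Incidence is given by a partial order. -/
  [partialOrder : PartialOrder Face]
  /-- There are a least face `⊥` and a greatest face `⊤`. -/
  [boundedOrder : BoundedOrder Face]
  /-- The rank function. -/
  rank : Face → ℤ
  rank_strictMono : StrictMono rank
  /-- The rank goes up in steps of one, so that each flag has a face of each rank
  `-1, 0, …, n`, and therefore contains `n + 2` faces. -/
  rank_covBy : ∀ F G : Face, F ⋖ G → rank G = rank F + 1
  rank_bot : rank ⊥ = -1
  rank_top : rank ⊤ = n
  /-- If `F < G` have ranks `j - 1` and `j + 1`, then exactly two faces lie strictly between. -/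
  diamond : ∀ F G : Face, F < G → rank G = rank F + 2 → (Set.Ioo F G).ncard = 2
  /-- Strong flag-connectedness: each section `G / F = {H | F ≤ H ≤ G}` has a connected
  flag graph. -/
  strongly_flag_connected : ∀ F G : Face, F ≤ G →
    (flagGraph (fun H : Set.Icc F G => rank H)).Connected

attribute [instance] AbstractPolytope.partialOrder AbstractPolytope.boundedOrder

namespace AbstractPolytope

/-- A polytope is regular if its automorphism group is transitive on its flags. -/
def IsRegular {n : ℤ} (P : AbstractPolytope.{u} n) : Prop :=
  ∀ Φ Ψ : Flag P.Face, ∃ γ : P.Face ≃o P.Face, Flag.map γ Φ = Ψ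

/-- A covering `η : R → P` of `n`-polytopes: a rank and adjacency preserving homomorphism. -/
structure IsCovering {n : ℤ} (R : AbstractPolytope.{u} n) (P : AbstractPolytope.{v} n)
    (η : R.Face → P.Face) : Prop where
  monotone : Monotone η
  rank_eq : ∀ F, P.rank (η F) = R.rank F
  /-- The images of two `j`-adjacent flags are again two `j`-adjacent flags. -/
  adjacent : ∀ (j : ℤ) (Φ Ψ : Flag R.Face), FlagAdjAt R.rank j Φ Ψ →
    ∃ Φ' Ψ' : Flag P.Face, (Φ' : Set P.Face) = η '' Φ ∧ (Ψ' : Set P.Face) = η '' Ψ ∧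
      FlagAdjAt P.rank j Φ' Ψ'

/-- `R` covers `P` if there is a covering `R → P`. -/
def Covers {n : ℤ} (R : AbstractPolytope.{u} n) (P : AbstractPolytope.{v} n) : Prop :=
  ∃ η : R.Face → P.Face, IsCovering R P η

/-- All `k`-faces `F` of `P`, regarded as the sections `F / ⊥`, are isomorphic to `K`. -/
def AllFacesIso {n : ℤ} (P : AbstractPolytope.{u} n) (k : ℤ) (K : AbstractPolytope.{v} k) : Prop :=
  ∀ F : P.Face, P.rank F = k → Nonempty (Set.Icc ⊥ F ≃o K.Face)

end AbstractPolytope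

/-!
Let `G = ⟨g₀, …, gₙ₋₁⟩` be an sggi whose first `k` generators satisfy the intersection condition.
For `m = 0, …, n` truncate the generators, replacing `gᵢ` by `1` unless `i < max k m`, and let `Γ`
be the subgroup of `G ^ (n + 1)` generated by the tuples of these truncations. For `m ≥ k`,
replacing the `l`-th coordinate by the `min m l`-th one fixes the first `m` generators of `Γ` and
kills the others. Such a retraction forces the intersection condition to pass from the first `m` to
the first `m + 1` generators, so `Γ` is a string C-group. It covers `G`, and the covering is
injective on the subgroup generated by the first `k` generators. For `k = 0` this is part (a).

For part (b), let `sᵢ` be the permutation of the flags of the polytope `Q` that takes each flag to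
the `i`-adjacent one. The connection group `⟨s₀, …, sₙ₋₁⟩` is an sggi, covered by a string C-group
`Γ`. The cosets of the subgroups `⟨γᵢ : i ≠ j⟩` of `Γ` are the faces of a regular polytope `R`, and
`R` covers `Q`: the flag of cosets through `x` goes to `x⁻¹ Φ₀`, for a fixed flag `Φ₀` of `Q`. If
the `k`-faces of `Q` are regular and isomorphic to each other, then `⟨s₀, …, sₖ₋₁⟩` acts freely on
the flags. Hence the first `k` of the `sᵢ` satisfy the intersection condition, so that `Γ` can be
chosen such that the first `k` of its generators generate a group that acts freely on the flags, and
then `R → Q` is an isomorphism on each `k`-face.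
-/

/-! ### Parabolic subgroups and the intersection condition -/

section Parabolic

variable {ι : Type*} {G : Type u} {H : Type v} [Group G] [Group H] {g : ι → G} {I J : Set ι}

/-- The subgroup `⟨gᵢ : i ∈ I⟩`, called parabolic as for Coxeter groups. -/
def parabolic (g : ι → G) (I : Set ι) : Subgroup G :=
  Subgroup.closure (g '' I)

theorem parabolic_mono (h : I ⊆ J) : parabolic g I ≤ parabolic g J :=
  Subgroup.closure_mono (Set.image_mono h)

theorem mem_parabolic {i : ι} (hi : i ∈ I) : g i ∈ parabolic g I :=
  Subgroup.subset_closure (Set.mem_image_of_mem g hi)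

theorem map_parabolic (φ : G →* H) (g : ι → G) (I : Set ι) :
    (parabolic g I).map φ = parabolic (φ ∘ g) I := by
  rw [parabolic, MonoidHom.map_closure, ← Set.image_comp, parabolic]

theorem exists_mul_of_mem_parabolic_union (hcomm : ∀ i ∈ I, ∀ j ∈ J, Commute (g i) (g j)) {x : G}
    (hx : x ∈ parabolic g (I ∪ J)) : ∃ a ∈ parabolic g I, ∃ b ∈ parabolic g J, a * b = x := by
  have hcomm' : ∀ (a : parabolic g I) (b : parabolic g J),
      Commute ((parabolic g I).subtype a) ((parabolic g J).subtype b) := by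
    have hcent : parabolic g I ≤ Subgroup.centralizer (parabolic g J) := by
      rw [parabolic, parabolic, Subgroup.centralizer_closure, Subgroup.closure_le]
      rintro _ ⟨i, hi, rfl⟩
      rw [SetLike.mem_coe, Subgroup.mem_centralizer_iff]
      rintro _ ⟨j, hj, rfl⟩
      exact (hcomm i hi j hj).symm
    exact fun a b => (Subgroup.mem_centralizer_iff.1 (hcent a.2) b b.2).symm
  rw [parabolic, Set.image_union, Subgroup.closure_union, ← parabolic, ← parabolic,
    ← (parabolic g I).range_subtype, ← (parabolic g J).range_subtype,
    ← MonoidHom.noncommCoprod_range _ _ hcomm'] at hx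
  obtain ⟨⟨a, b⟩, rfl⟩ := hx
  exact ⟨a, a.2, b, b.2, rfl⟩

theorem parabolic_inf_le_of_retraction (π : G →* G) (hfix : ∀ i ∈ I, π (g i) = g i)
    (hkill : ∀ i ∉ I, π (g i) = 1) : parabolic g I ⊓ parabolic g J ≤ parabolic g (I ∩ J) := by
  rintro x ⟨hxI, hxJ⟩
  have hπx : π x = x := MonoidHom.eqOn_closure (f := π) (g := MonoidHom.id G)
    (by rintro _ ⟨i, hi, rfl⟩; exact hfix i hi) hxI
  rw [← hπx]
  suffices parabolic g J ≤ (parabolic g (I ∩ J)).comap π from this hxJ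
  rw [parabolic, Subgroup.closure_le]
  rintro _ ⟨i, hi, rfl⟩
  rw [SetLike.mem_coe, Subgroup.mem_comap]
  by_cases hiI : i ∈ I
  · rw [hfix i hiI]
    exact mem_parabolic ⟨hiI, hi⟩
  · rw [hkill i hiI]
    exact one_mem _

/-- The intersection condition, restricted to subfamilies of the `gᵢ` with `i ∈ L`. -/
def IntersectionOn (g : ι → G) (L : Set ι) : Prop :=
  ∀ I ⊆ L, ∀ J ⊆ L, parabolic g I ⊓ parabolic g J ≤ parabolic g (I ∩ J)

theorem IntersectionOn.of_injOn {L : Set ι} (φ : G →* H) (hφ : Set.InjOn φ (parabolic g L))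
    (h : IntersectionOn (φ ∘ g) L) : IntersectionOn g L := by
  rintro I hI J hJ x ⟨hxI, hxJ⟩
  have hφx : φ x ∈ parabolic (φ ∘ g) I ⊓ parabolic (φ ∘ g) J := by
    rw [← map_parabolic, ← map_parabolic]
    exact ⟨Subgroup.mem_map_of_mem φ hxI, Subgroup.mem_map_of_mem φ hxJ⟩
  have hφx' := h I hI J hJ hφx
  rw [← map_parabolic] at hφx'
  obtain ⟨y, hy, hyx⟩ := hφx'
  rwa [← hφ (parabolic_mono (Set.inter_subset_left.trans hI) hy) (parabolic_mono hI hxI) hyx]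

end Parabolic

section Below

variable {n : ℕ}

/-- The set of indices less than `m`. -/
def below (m : ℤ) : Set (Fin n) :=
  {i | (i : ℤ) < m}

@[simp]
theorem mem_below {m : ℤ} {i : Fin n} : i ∈ below m ↔ (i : ℤ) < m :=
  Iff.rfl

theorem exists_maximal_run (T : Set (Fin n)) (m : ℕ) :
    ∃ b ≤ m, below m ⊆ below b ∪ T ∧ ∀ i ∈ T, (i : ℕ) + 1 ≠ b := by
  induction m with
  | zero => exact ⟨0, le_rfl, Set.subset_union_left, fun i _ => Nat.succ_ne_zero _⟩
  | succ m ih =>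
    by_cases hm : ∃ i ∈ T, (i : ℕ) = m
    · obtain ⟨j, hjT, hjm⟩ := hm
      obtain ⟨b, hbm, hrun, hb⟩ := ih
      refine ⟨b, by omega, fun i hi => ?_, hb⟩
      rcases eq_or_ne i j with rfl | hij
      · exact Or.inr hjT
      · exact hrun (mem_below.2 (by have := Fin.val_ne_of_ne hij; have := mem_below.1 hi; omega))
    · exact ⟨m + 1, le_rfl, Set.subset_union_left, fun i hi him => hm ⟨i, hi, by omega⟩⟩

variable {G : Type u} [Group G] {g : Fin n → G}

theorem parabolic_below_zero (g : Fin n → G) : parabolic g (below 0) = ⊥ := by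
  have hempty : below (n := n) 0 = ∅ := Set.eq_empty_of_forall_notMem fun i hi => by
    rw [mem_below] at hi
    omega
  rw [hempty, parabolic, Set.image_empty, Subgroup.closure_empty]

theorem exists_mul_of_mem_parabolic_of_ne (hcomm : ∀ i j : Fin n, (i : ℕ) + 1 < j →
    Commute (g i) (g j)) {I : Set (Fin n)} {m : ℤ} (hI : ∀ i ∈ I, (i : ℤ) ≠ m) {x : G}
    (hx : x ∈ parabolic g I) :
    ∃ a ∈ parabolic g (I ∩ below m), ∃ b ∈ parabolic g (I ∩ {i | m < i}), a * b = x := by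
  apply exists_mul_of_mem_parabolic_union
  · rintro i ⟨_, hi⟩ j ⟨_, hj⟩
    rw [mem_below] at hi
    rw [Set.mem_ofPred_eq] at hj
    exact hcomm i j (by omega)
  · exact parabolic_mono (fun i hi => (hI i hi).lt_or_gt.imp (⟨hi, ·⟩) (⟨hi, ·⟩)) hx

theorem IntersectionOn.below_succ (hcomm : ∀ i j : Fin n, (i : ℕ) + 1 < j → Commute (g i) (g j))
    {m : ℕ} (h : IntersectionOn g (below m))
    (hm : ∀ J, parabolic g (below m) ⊓ parabolic g J ≤ parabolic g (below m ∩ J)) :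
    IntersectionOn g (below (m + 1 : ℕ)) := by
  rintro I hI J hJ x ⟨hxI, hxJ⟩
  obtain ⟨b, hbm, hrun, hb⟩ := exists_maximal_run (I ∩ J) (m + 1)
  wlog hbJ : ∀ i ∈ J, (i : ℤ) ≠ b - 1 generalizing I J
  · rw [Set.inter_comm]
    refine this J hJ I hI hxJ hxI (by rwa [Set.inter_comm]) (by rwa [Set.inter_comm]) ?_
    push Not at hbJ
    obtain ⟨j, hj, hjb⟩ := hbJ
    intro i hi hib
    have hij : i = j := Fin.ext (by omega)
    exact hb i ⟨hi, hij ▸ hj⟩ (by omega)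
  obtain ⟨a, ha, c, hc, rfl⟩ := exists_mul_of_mem_parabolic_of_ne hcomm hbJ hxJ
  have hcIJ : c ∈ parabolic g (I ∩ J) := by
    refine parabolic_mono (fun i hi => (hrun (hJ hi.1)).resolve_left fun hib => ?_) hc
    have := mem_below.1 hib
    have : (b : ℤ) - 1 < i := hi.2
    omega
  have haI : a ∈ parabolic g I :=
    (Subgroup.mul_mem_cancel_right _ (parabolic_mono Set.inter_subset_left hcIJ)).1 hxI
  have hJm : J ∩ below (b - 1) ⊆ below m := fun i hi => by
    have := mem_below.1 hi.2
    exact mem_below.2 (by omega)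
  have haI' : a ∈ parabolic g (below m ∩ I) := hm I ⟨parabolic_mono hJm ha, haI⟩
  have haIJ : a ∈ parabolic g (below m ∩ I ∩ (J ∩ below (b - 1))) :=
    h _ Set.inter_subset_left _ hJm (Subgroup.mem_inf.2 ⟨haI', ha⟩)
  have hsub : below m ∩ I ∩ (J ∩ below (b - 1)) ⊆ I ∩ J := fun i hi => ⟨hi.1.2, hi.2.1⟩
  exact mul_mem (parabolic_mono hsub haIJ) hcIJ

end Below

/-! ### Covers of sggis by string C-groups -/

namespace IsSggi

variable {n : ℕ} {G : Type u} [Group G] {g : Fin n → G}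

theorem mul_self (hg : IsSggi g) (i : Fin n) : g i * g i = 1 := by
  rw [← pow_two, ← hg.orderOf_eq_two i, pow_orderOf_eq_one]

theorem ne_one (hg : IsSggi g) (i : Fin n) : g i ≠ 1 := fun h => by
  simpa [h] using hg.orderOf_eq_two i

theorem commute (hg : IsSggi g) {i j : Fin n} (hij : (i : ℕ) + 1 < j) :
    Commute (g i) (g j) := by
  have hinv (k : Fin n) : (g k)⁻¹ = g k := inv_eq_of_mul_eq_one_right (hg.mul_self k)
  have hprod : (g i * g j) * (g i * g j) = 1 := by rw [← pow_two, hg.mul_sq_eq_one i j hij]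
  rw [commute_iff_eq, ← inv_eq_of_mul_eq_one_right hprod, mul_inv_rev, hinv, hinv]

theorem eq_one_or_eq_of_mem_parabolic_singleton (hg : IsSggi g) {i : Fin n} {x : G}
    (hx : x ∈ parabolic g {i}) : x = 1 ∨ x = g i := by
  rw [parabolic, Set.image_singleton, ← Subgroup.zpowers_eq_closure] at hx
  obtain ⟨k, rfl⟩ := hx
  have hsq (m : ℤ) : g i ^ (2 * m) = 1 := by rw [zpow_mul, zpow_two, hg.mul_self, one_zpow]
  rcases Int.even_or_odd' k with ⟨m, rfl | rfl⟩
  · exact .inl (hsq m)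
  · exact .inr (by simp only [zpow_add_one, hsq, one_mul])

theorem exists_mul (hg : IsSggi g) {I : Set (Fin n)} {m : ℤ} (hI : ∀ i ∈ I, (i : ℤ) ≠ m) {x : G}
    (hx : x ∈ parabolic g I) :
    ∃ a ∈ parabolic g (I ∩ below m), ∃ b ∈ parabolic g (I ∩ {i | m < i}), a * b = x :=
  exists_mul_of_mem_parabolic_of_ne (fun _ _ => hg.commute) hI hx

end IsSggi

section SpanGen

variable {n : ℕ} {G : Type u} [Group G]

/-- The family `g`, regarded as a family of generators of the subgroup that it generates. -/
def spanGen (g : Fin n → G) (i : Fin n) : Subgroup.closure (Set.range g) :=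
  ⟨g i, Subgroup.subset_closure (Set.mem_range_self i)⟩

theorem isSggi_spanGen {g : Fin n → G} (hsq : ∀ i, g i * g i = 1) (hne : ∀ i, g i ≠ 1)
    (hcomm : ∀ i j : Fin n, (i : ℕ) + 1 < j → Commute (g i) (g j)) : IsSggi (spanGen g) where
  closure_eq_top := by
    rw [← Subgroup.closure_closure_coe_preimage (k := Set.range g)]
    congr 1
    ext x
    simp only [spanGen, Set.mem_range, Subtype.ext_iff, Set.mem_preimage]
  orderOf_eq_two i := by
    rw [← Subgroup.orderOf_coe]
    exact orderOf_eq_prime ((pow_two _).trans (hsq i)) (hne i)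
  mul_sq_eq_one i j hij := Subtype.ext <| by
    change (g i * g j) ^ 2 = 1
    rw [(hcomm i j hij).mul_pow, pow_two, pow_two, hsq, hsq, one_mul]

theorem isStringCGroup_spanGen {g : Fin n → G} (hsgg : IsSggi (spanGen g))
    (h : IntersectionOn g Set.univ) : IsStringCGroup (spanGen g) where
  toIsSggi := hsgg
  inter_eq I J := by
    refine le_antisymm ?_
      (le_inf (parabolic_mono Set.inter_subset_left) (parabolic_mono Set.inter_subset_right))
    have hspan : IntersectionOn (spanGen g) Set.univ :=
      .of_injOn (Subgroup.subtype _) (Subgroup.subtype_injective _).injOn h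
    exact hspan I (Set.subset_univ _) J (Set.subset_univ _)

end SpanGen

section Truncation

variable {n : ℕ} {G : Type u} [Group G] {g : Fin n → G} {k : ℕ}

/-- The element of `G ^ (n + 1)` whose `m`-th coordinate is `gᵢ` if `i < max k m` and is `1`
otherwise. Thus the `m`-th coordinates are a truncation of `g` to its first `max k m` entries. -/
def truncation (g : Fin n → G) (k : ℕ) (i : Fin n) : Fin (n + 1) → G :=
  fun m => if (i : ℕ) < max k m then g i else 1

theorem truncation_apply_last (i : Fin n) : truncation g k i (Fin.last n) = g i :=
  if_pos (by simp)

theorem isSggi_spanGen_truncation (hg : IsSggi g) : IsSggi (spanGen (truncation g k)) := by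
  refine isSggi_spanGen (fun i => funext fun m => ?_) (fun i hi => hg.ne_one i ?_)
    fun i j hij => funext fun m => ?_
  · by_cases him : (i : ℕ) < max k m <;>
      simp only [Pi.mul_apply, Pi.one_apply, truncation, him, if_true, if_false, hg.mul_self,
        one_mul]
  · rw [← truncation_apply_last (g := g) (k := k), hi, Pi.one_apply]
  · simp only [Pi.mul_apply, truncation]
    split_ifs <;> simp only [one_mul, mul_one, (hg.commute hij).eq]

theorem eq_of_mem_parabolic_truncation {x : Fin (n + 1) → G}
    (hx : x ∈ parabolic (truncation g k) (below k)) (m : Fin (n + 1)) : x m = x (Fin.last n) := by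
  refine MonoidHom.eqOn_closure (f := Pi.evalMonoidHom (fun _ => G) m)
    (g := Pi.evalMonoidHom (fun _ => G) (Fin.last n)) ?_ hx
  rintro _ ⟨i, hi, rfl⟩
  refine Eq.trans ?_ (truncation_apply_last i).symm
  exact if_pos (lt_max_of_lt_left (by exact_mod_cast mem_below.1 hi))

theorem injOn_parabolic_truncation :
    Set.InjOn (Pi.evalMonoidHom (fun _ : Fin (n + 1) => G) (Fin.last n))
      (parabolic (truncation g k) (below k)) := fun x hx y hy hxy => funext fun m => by
  rw [eq_of_mem_parabolic_truncation hx m, eq_of_mem_parabolic_truncation hy m]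
  exact hxy

theorem parabolic_truncation_inf_le {m : ℕ} (hkm : k ≤ m) (hmn : m ≤ n) (J : Set (Fin n)) :
    parabolic (truncation g k) (below m) ⊓ parabolic (truncation g k) J ≤
      parabolic (truncation g k) (below m ∩ J) := by
  let m' : Fin (n + 1) := ⟨m, by omega⟩
  have hmin (l : Fin (n + 1)) : ((min m' l : Fin (n + 1)) : ℕ) = min m l := Fin.coe_min m' l
  refine parabolic_inf_le_of_retraction
    (MonoidHom.pi fun l => Pi.evalMonoidHom (fun _ => G) (min m' l)) (fun i hi => ?_) fun i hi => ?_
  · ext l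
    simp only [MonoidHom.pi_apply, Pi.evalMonoidHom_apply, truncation, hmin]
    rw [mem_below] at hi
    exact if_congr (by omega) rfl rfl
  · ext l
    simp only [MonoidHom.pi_apply, Pi.evalMonoidHom_apply, truncation, hmin]
    rw [mem_below] at hi
    exact if_neg (by omega)

theorem intersectionOn_truncation (hg : IsSggi g) (hk : k ≤ n)
    (h : IntersectionOn g (below k)) : IntersectionOn (truncation g k) Set.univ := by
  have hcomm (i j : Fin n) (hij : (i : ℕ) + 1 < j) :
      Commute (truncation g k i) (truncation g k j) :=
    congrArg Subtype.val ((isSggi_spanGen_truncation hg).commute hij)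
  have hbelow (m : ℕ) (hkm : k ≤ m) : m ≤ n → IntersectionOn (truncation g k) (below m) := by
    induction m, hkm using Nat.le_induction with
    | base =>
      refine fun _ => .of_injOn (Pi.evalMonoidHom (fun _ => G) (Fin.last n))
        injOn_parabolic_truncation ?_
      rwa [show Pi.evalMonoidHom (fun _ => G) (Fin.last n) ∘ truncation g k = g from
        funext truncation_apply_last]
    | succ m hkm ih =>
      exact fun hmn => (ih (by omega)).below_succ hcomm (parabolic_truncation_inf_le hkm (by omega))
  have huniv : (Set.univ : Set (Fin n)) = below n := by ext i; simp
  exact huniv ▸ hbelow n hk le_rfl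

end Truncation

theorem IsSggi.exists_isStringCGroup_hom_injOn {n k : ℕ} {G : Type u} [Group G] {g : Fin n → G}
    (hg : IsSggi g) (hk : k ≤ n) (h : IntersectionOn g (below k)) :
    ∃ (Γ : Type u) (_ : Group Γ) (_ : Finite G → Finite Γ) (γ : Fin n → Γ) (φ : Γ →* G),
      IsStringCGroup γ ∧ Function.Surjective φ ∧ (∀ i, φ (γ i) = g i) ∧
        Set.InjOn φ (parabolic γ (below k)) := by
  let φ : Subgroup.closure (Set.range (truncation g k)) →* G :=
    (Pi.evalMonoidHom (fun _ => G) (Fin.last n)).comp (Subgroup.subtype _)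
  have hφ (i : Fin n) : φ (spanGen (truncation g k) i) = g i := truncation_apply_last i
  have hcoe {x : Subgroup.closure (Set.range (truncation g k))}
      (hx : x ∈ parabolic (spanGen (truncation g k)) (below k)) :
      (x : Fin (n + 1) → G) ∈ parabolic (truncation g k) (below k) := by
    have hx' := Subgroup.mem_map_of_mem (Subgroup.closure (Set.range (truncation g k))).subtype hx
    rwa [map_parabolic] at hx'
  refine ⟨Subgroup.closure (Set.range (truncation g k)), inferInstance, fun _ => inferInstance,
    spanGen (truncation g k), φ, isStringCGroup_spanGen (isSggi_spanGen_truncation hg)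
      (intersectionOn_truncation hg hk h), ?_, hφ, fun x hx y hy hxy =>
      Subtype.ext (injOn_parabolic_truncation (hcoe hx) (hcoe hy) hxy)⟩
  rw [← MonoidHom.range_eq_top, eq_top_iff, ← hg.closure_eq_top, Subgroup.closure_le]
  rintro _ ⟨i, rfl⟩
  exact ⟨_, hφ i⟩

/-! ### Flags of partial orders -/

section Flags

variable {α : Type u} [PartialOrder α]

theorem flag_eq_of_subset {Φ Ψ : Flag α} (h : ∀ a ∈ Φ, a ∈ Ψ) : Φ = Ψ :=
  SetLike.coe_injective (Φ.max_chain' Ψ.chain_le h)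

theorem apply_mem_flag_map {β : Type v} [PartialOrder β] (e : α ≃o β) {Φ : Flag α} {a : α} :
    e a ∈ Flag.map e Φ ↔ a ∈ Φ :=
  e.injective.mem_set_image

theorem eq_of_mem_flag_of_strictMono {r : α → ℤ} (hr : StrictMono r) {Φ : Flag α} {a b : α}
    (ha : a ∈ Φ) (hb : b ∈ Φ) (h : r a = r b) : a = b :=
  (Φ.le_or_le ha hb).elim (fun hab => hab.eq_of_not_lt fun hlt => (hr hlt).ne h)
    fun hba => (hba.eq_of_not_lt fun hlt => (hr hlt).ne' h).symm

theorem lt_of_mem_flag_of_strictMono {r : α → ℤ} (hr : StrictMono r) {Φ : Flag α} {a b : α}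
    (ha : a ∈ Φ) (hb : b ∈ Φ) (h : r a < r b) : a < b :=
  ((Φ.le_or_le ha hb).resolve_right fun hba => (hr.monotone hba).not_gt h).lt_of_ne fun hab =>
    h.ne (congrArg r hab)

theorem FlagAdjAt.symm {r : α → ℤ} {j : ℤ} {Φ Ψ : Flag α} (h : FlagAdjAt r j Φ Ψ) :
    FlagAdjAt r j Ψ Φ :=
  ⟨h.1.symm, fun a ha => (h.2 a ha).symm⟩

/-- The flag that `Φ` induces on the section `G / F`, where `F` and `G` belong to `Φ`. -/
def sectionFlag (Φ : Flag α) {F G : α} (hF : F ∈ Φ) (hG : G ∈ Φ) : Flag (Set.Icc F G) where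
  carrier := {x | (x : α) ∈ Φ}
  Chain' _ hx _ hy _ := Φ.le_or_le hx hy
  max_chain' s hs hsub := hsub.antisymm fun x hx => by
    refine Flag.mem_iff_forall_le_or_ge.2 fun a ha => ?_
    rcases Φ.le_or_le ha hF with haF | hFa
    · exact Or.inr (haF.trans x.2.1)
    rcases Φ.le_or_le ha hG with haG | hGa
    · exact hs.total hx (hsub (a := ⟨a, hFa, haG⟩) ha)
    · exact Or.inl (x.2.2.trans hGa)

theorem mem_sectionFlag {Φ : Flag α} {F G : α} {hF : F ∈ Φ} {hG : G ∈ Φ} {x : Set.Icc F G} :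
    x ∈ sectionFlag Φ hF hG ↔ (x : α) ∈ Φ :=
  Iff.rfl

end Flags

/-! ### Flags of abstract polytopes -/

namespace AbstractPolytope

section Rank

variable {n : ℤ} {Q : AbstractPolytope.{u} n}

theorem neg_one_le_rank (F : Q.Face) : -1 ≤ Q.rank F :=
  Q.rank_bot.symm.trans_le (Q.rank_strictMono.monotone bot_le)

theorem rank_le (F : Q.Face) : Q.rank F ≤ n :=
  (Q.rank_strictMono.monotone le_top).trans_eq Q.rank_top

theorem eq_of_mem_flag {Φ : Flag Q.Face} {F G : Q.Face} (hF : F ∈ Φ) (hG : G ∈ Φ)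
    (h : Q.rank F = Q.rank G) : F = G :=
  eq_of_mem_flag_of_strictMono Q.rank_strictMono hF hG h

theorem lt_of_mem_flag {Φ : Flag Q.Face} {F G : Q.Face} (hF : F ∈ Φ) (hG : G ∈ Φ)
    (h : Q.rank F < Q.rank G) : F < G :=
  lt_of_mem_flag_of_strictMono Q.rank_strictMono hF hG h

theorem le_of_mem_flag {Φ : Flag Q.Face} {F G : Q.Face} (hF : F ∈ Φ) (hG : G ∈ Φ)
    (h : Q.rank F ≤ Q.rank G) : F ≤ G :=
  h.lt_or_eq.elim (fun hlt => (lt_of_mem_flag hF hG hlt).le)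
    fun heq => (eq_of_mem_flag hF hG heq).le

theorem exists_mem_flag_rank_eq (Φ : Flag Q.Face) {i : ℤ} (h1 : -1 ≤ i) (h2 : i ≤ n) :
    ∃ F ∈ Φ, Q.rank F = i := by
  obtain ⟨a, ⟨F, hF, rfl, hFi⟩, hmax⟩ :=
    Int.exists_greatest_of_bdd (P := fun z => ∃ F ∈ Φ, Q.rank F = z ∧ z ≤ i)
      ⟨i, fun _ ⟨_, _, _, hz⟩ => hz⟩ ⟨-1, ⊥, Φ.bot_mem, Q.rank_bot, h1⟩
  obtain ⟨b, ⟨G, hG, rfl, hGi⟩, hmin⟩ :=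
    Int.exists_least_of_bdd (P := fun z => ∃ F ∈ Φ, Q.rank F = z ∧ i ≤ z)
      ⟨i, fun _ ⟨_, _, _, hz⟩ => hz⟩ ⟨n, ⊤, Φ.top_mem, Q.rank_top, h2⟩
  refine ⟨F, hF, hFi.eq_of_not_lt fun hFi => ?_⟩
  have hGi : i < Q.rank G := hGi.lt_of_ne fun hGi => by
    have := hmax _ ⟨G, hG, rfl, hGi.ge⟩
    lia
  have hcov : F ⋖ G := by
    refine ⟨lt_of_mem_flag hF hG (hFi.trans hGi), fun H hFH hHG => ?_⟩
    have hH : H ∈ Φ := Flag.mem_iff_forall_le_or_ge.2 fun M hM => by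
      rcases le_total (Q.rank M) i with hMi | hMi
      · exact Or.inr ((le_of_mem_flag hM hF (hmax _ ⟨M, hM, rfl, hMi⟩)).trans hFH.le)
      · exact Or.inl (hHG.le.trans (le_of_mem_flag hG hM (hmin _ ⟨M, hM, rfl, hMi⟩)))
    have hFH := Q.rank_strictMono hFH
    have hHG := Q.rank_strictMono hHG
    rcases le_total (Q.rank H) i with hHi | hHi
    · exact (hmax _ ⟨H, hH, rfl, hHi⟩).not_gt hFH
    · exact (hmin _ ⟨H, hH, rfl, hHi⟩).not_gt hHG
  have := Q.rank_covBy F G hcov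
  lia

/-- The flags `Φ` and `Ψ` contain the same faces of each rank in `R`. -/
def AgreeOn (R : Set ℤ) (Φ Ψ : Flag Q.Face) : Prop :=
  ∀ F, Q.rank F ∈ R → (F ∈ Φ ↔ F ∈ Ψ)

theorem AgreeOn.of_forall_mem {R : Set ℤ} {Φ Ψ : Flag Q.Face}
    (h : ∀ F ∈ Φ, Q.rank F ∈ R → F ∈ Ψ) : AgreeOn R Φ Ψ := by
  refine fun F hFR => ⟨fun hF => h F hF hFR, fun hF => ?_⟩
  obtain ⟨G, hG, hGF⟩ := exists_mem_flag_rank_eq Φ (neg_one_le_rank F) (rank_le F)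
  rwa [eq_of_mem_flag hF (h G hG (hGF ▸ hFR)) hGF.symm]

theorem AgreeOn.symm {R : Set ℤ} {Φ Ψ : Flag Q.Face} (h : AgreeOn R Φ Ψ) : AgreeOn R Ψ Φ :=
  fun F hF => (h F hF).symm

theorem AgreeOn.trans {R : Set ℤ} {Φ Ψ Ω : Flag Q.Face} (h₁ : AgreeOn R Φ Ψ)
    (h₂ : AgreeOn R Ψ Ω) : AgreeOn R Φ Ω :=
  fun F hF => (h₁ F hF).trans (h₂ F hF)

theorem AgreeOn.mono {R S : Set ℤ} {Φ Ψ : Flag Q.Face} (hRS : R ⊆ S) (h : AgreeOn S Φ Ψ) :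
    AgreeOn R Φ Ψ :=
  fun F hF => h F (hRS hF)

theorem notMem_of_flagAdjAt {Φ Ψ : Flag Q.Face} {i : ℤ} (h : FlagAdjAt Q.rank i Φ Ψ) {F : Q.Face}
    (hF : F ∈ Φ) (hFi : Q.rank F = i) : F ∉ Ψ := fun hFΨ =>
  h.1 <| flag_eq_of_subset fun M hM => by
    by_cases hMi : Q.rank M = i
    · rwa [eq_of_mem_flag hM hF (hMi.trans hFi.symm)]
    · exact (h.2 M hMi).1 hM

theorem mem_flag_of_lt_of_lt {Φ Ψ : Flag Q.Face} {i : ℤ} (hadj : FlagAdjAt Q.rank i Φ Ψ)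
    {A B H : Q.Face} (hA : A ∈ Φ) (hB : B ∈ Φ) (hAi : Q.rank A = i - 1) (hBi : Q.rank B = i + 1)
    (hAH : A < H) (hHB : H < B) (hH : H ∉ Φ) : H ∈ Ψ := by
  have hA' : A ∈ Ψ := (hadj.2 A (by lia)).1 hA
  have hB' : B ∈ Ψ := (hadj.2 B (by lia)).1 hB
  have hi1 := neg_one_le_rank A
  have hi2 := rank_le B
  obtain ⟨F, hF, hFi⟩ := exists_mem_flag_rank_eq Φ (i := i) (by lia) (by lia)
  obtain ⟨F', hF', hFi'⟩ := exists_mem_flag_rank_eq Ψ (i := i) (by lia) (by lia)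
  have hne : F' ≠ F := fun h => notMem_of_flagAdjAt hadj hF hFi (h ▸ hF')
  obtain ⟨X, Y, -, hXY⟩ := Set.ncard_eq_two.1 (Q.diamond A B (hAH.trans hHB) (by lia))
  have hIoo {M : Q.Face} (h : M ∈ Set.Ioo A B) : M = X ∨ M = Y := by rwa [hXY] at h
  have hHF : H ≠ F := fun h => hH (h ▸ hF)
  have hFIoo : F ∈ Set.Ioo A B :=
    ⟨lt_of_mem_flag hA hF (by lia), lt_of_mem_flag hF hB (by lia)⟩
  have hFIoo' : F' ∈ Set.Ioo A B :=
    ⟨lt_of_mem_flag hA' hF' (by lia), lt_of_mem_flag hF' hB' (by lia)⟩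
  have hHF' : H = F' := by
    rcases hIoo hFIoo with rfl | rfl <;> rcases hIoo hFIoo' with rfl | rfl <;>
      rcases hIoo ⟨hAH, hHB⟩ with rfl | rfl <;> first | rfl | contradiction
  rwa [hHF']

end Rank

section FlagSwap

variable {N : ℕ} {Q : AbstractPolytope.{u} N}

theorem exists_mem_flag_near (Φ : Flag Q.Face) (i : Fin N) :
    ∃ A ∈ Φ, ∃ F ∈ Φ, ∃ B ∈ Φ, Q.rank A = i - 1 ∧ Q.rank F = i ∧ Q.rank B = i + 1 := by
  obtain ⟨A, hA, hAi⟩ := exists_mem_flag_rank_eq Φ (i := i - 1) (by omega) (by omega)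
  obtain ⟨F, hF, hFi⟩ := exists_mem_flag_rank_eq Φ (i := i) (by omega) (by omega)
  obtain ⟨B, hB, hBi⟩ := exists_mem_flag_rank_eq Φ (i := i + 1) (by omega) (by omega)
  exact ⟨A, hA, F, hF, B, hB, hAi, hFi, hBi⟩

theorem exists_flagAdjAt (Φ : Flag Q.Face) (i : Fin N) : ∃ Ψ, FlagAdjAt Q.rank i Φ Ψ := by
  obtain ⟨A, hA, F, hF, B, hB, hAi, hFi, hBi⟩ := exists_mem_flag_near Φ i
  have hFIoo : F ∈ Set.Ioo A B :=
    ⟨lt_of_mem_flag hA hF (by lia), lt_of_mem_flag hF hB (by lia)⟩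
  obtain ⟨F', hF', hne⟩ : ∃ F' ∈ Set.Ioo A B, F' ≠ F :=
    Set.exists_ne_of_one_lt_ncard
      (by rw [Q.diamond A B (hFIoo.1.trans hFIoo.2) (by lia)]; exact one_lt_two) F
  have hFi' : Q.rank F' = i := by
    have := Q.rank_strictMono hF'.1
    have := Q.rank_strictMono hF'.2
    lia
  have hchain : IsChain (· ≤ ·) (insert F' {M | M ∈ Φ ∧ Q.rank M ≠ i}) := by
    refine IsChain.insert (fun M hM L hL _ => Φ.le_or_le hM.1 hL.1) fun M hM _ => ?_
    rcases hM.2.lt_or_gt with hMi | hMi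
    · exact Or.inr ((le_of_mem_flag hM.1 hA (by lia)).trans hF'.1.le)
    · exact Or.inl (hF'.2.le.trans (le_of_mem_flag hB hM.1 (by lia)))
  obtain ⟨Ψ, hΨ⟩ := hchain.exists_subset_flag
  have hF'Ψ : F' ∈ Ψ := hΨ (Set.mem_insert _ _)
  refine ⟨Ψ, ?_, AgreeOn.of_forall_mem (R := {(i : ℤ)}ᶜ) fun M hM hMi => hΨ (Or.inr ⟨hM, hMi⟩)⟩
  rintro rfl
  exact hne (eq_of_mem_flag hF'Ψ hF (hFi'.trans hFi.symm))

theorem flagAdjAt_unique {Φ Ψ Ω : Flag Q.Face} {i : Fin N} (hΨ : FlagAdjAt Q.rank i Φ Ψ)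
    (hΩ : FlagAdjAt Q.rank i Φ Ω) : Ψ = Ω := by
  refine flag_eq_of_subset fun M hM => ?_
  by_cases hMi : Q.rank M = i
  · obtain ⟨A, hA, -, -, B, hB, hAi, -, hBi⟩ := exists_mem_flag_near Φ i
    exact mem_flag_of_lt_of_lt hΩ hA hB hAi hBi
      (lt_of_mem_flag ((hΨ.2 A (by lia)).1 hA) hM (by lia))
      (lt_of_mem_flag hM ((hΨ.2 B (by lia)).1 hB) (by lia))
      (notMem_of_flagAdjAt hΨ.symm hM hMi)
  · exact (hΩ.2 M hMi).1 ((hΨ.2 M hMi).2 hM)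

/-- The permutation of the flags of `Q` that takes each flag to the `i`-adjacent one. -/
noncomputable def flagSwap (Q : AbstractPolytope.{u} N) (i : Fin N) :
    Equiv.Perm (Flag Q.Face) :=
  Function.Involutive.toPerm (fun Φ => (exists_flagAdjAt Φ i).choose) fun Φ =>
    flagAdjAt_unique (exists_flagAdjAt _ i).choose_spec (exists_flagAdjAt Φ i).choose_spec.symm

theorem flagAdjAt_flagSwap (i : Fin N) (Φ : Flag Q.Face) :
    FlagAdjAt Q.rank i Φ (Q.flagSwap i Φ) :=
  (exists_flagAdjAt Φ i).choose_spec

theorem flagSwap_eq_of_flagAdjAt {i : Fin N} {Φ Ψ : Flag Q.Face} (h : FlagAdjAt Q.rank i Φ Ψ) :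
    Q.flagSwap i Φ = Ψ :=
  flagAdjAt_unique (flagAdjAt_flagSwap i Φ) h

theorem flagSwap_mul_self (i : Fin N) : Q.flagSwap i * Q.flagSwap i = 1 :=
  Equiv.ext fun Φ => flagSwap_eq_of_flagAdjAt (flagAdjAt_flagSwap i Φ).symm

theorem flagSwap_ne_one (i : Fin N) : Q.flagSwap i ≠ 1 := fun h => by
  obtain ⟨Φ⟩ := (inferInstance : Nonempty (Flag Q.Face))
  exact (flagAdjAt_flagSwap i Φ).1 (by rw [h, Equiv.Perm.one_apply])

theorem mem_flagSwap_iff {i : Fin N} {Φ : Flag Q.Face} {F : Q.Face} (hF : Q.rank F ≠ i) :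
    F ∈ Q.flagSwap i Φ ↔ F ∈ Φ :=
  ((flagAdjAt_flagSwap i Φ).2 F hF).symm

theorem flagSwap_commute {i j : Fin N} (hij : (i : ℕ) + 1 < j) :
    Commute (Q.flagSwap i) (Q.flagSwap j) := by
  refine Equiv.ext fun Φ => flagSwap_eq_of_flagAdjAt ⟨fun h => ?_, ?_⟩
  · have hΦ := (Q.flagSwap j).injective h
    exact (flagAdjAt_flagSwap i Φ).1 hΦ
  refine AgreeOn.of_forall_mem (R := {(i : ℤ)}ᶜ) fun H hH hHi => ?_
  by_cases hHj : Q.rank H = j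
  · obtain ⟨A, hA, -, -, B, hB, hAj, -, hBj⟩ := exists_mem_flag_near Φ j
    refine mem_flag_of_lt_of_lt (flagAdjAt_flagSwap j _) ((mem_flagSwap_iff (by omega)).2 hA)
      ((mem_flagSwap_iff (by omega)).2 hB) hAj hBj
      (lt_of_mem_flag ((mem_flagSwap_iff (by omega)).2 hA) hH (by omega))
      (lt_of_mem_flag hH ((mem_flagSwap_iff (by omega)).2 hB) (by omega)) ?_
    rw [mem_flagSwap_iff hHi]
    exact notMem_of_flagAdjAt (flagAdjAt_flagSwap j Φ).symm hH hHj
  · rwa [Equiv.Perm.mul_apply, mem_flagSwap_iff hHj, mem_flagSwap_iff hHi, ← mem_flagSwap_iff hHj]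

theorem exists_fin_of_flagAdjAt {j : ℤ} {Φ Ψ : Flag Q.Face} (h : FlagAdjAt Q.rank j Φ Ψ) :
    ∃ i : Fin N, (i : ℤ) = j := by
  obtain ⟨F, hFΦ, hFΨ⟩ : ∃ F ∈ Φ, F ∉ Ψ := by
    by_contra! hsub
    exact h.1 (flag_eq_of_subset hsub)
  have hFj : Q.rank F = j := of_not_not fun hFj => hFΨ ((h.2 F hFj).1 hFΦ)
  have hbot : ⊥ < F := bot_lt_iff_ne_bot.2 fun hF => hFΨ (hF ▸ Ψ.bot_mem)
  have htop : F < ⊤ := lt_top_iff_ne_top.2 fun hF => hFΨ (hF ▸ Ψ.top_mem)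
  have h1 := Q.rank_bot ▸ Q.rank_strictMono hbot
  have h2 := Q.rank_top ▸ Q.rank_strictMono htop
  exact ⟨⟨j.toNat, by lia⟩, by simp only [Int.ofNat_toNat]; lia⟩

end FlagSwap

end AbstractPolytope

/-! ### The connection group -/

namespace AbstractPolytope

section Connection

variable {N : ℕ} {Q : AbstractPolytope.{u} N}

theorem isSggi_spanGen_flagSwap (Q : AbstractPolytope.{u} N) : IsSggi (spanGen Q.flagSwap) :=
  isSggi_spanGen flagSwap_mul_self flagSwap_ne_one fun _ _ => flagSwap_commute

/-- The ranks in which the swaps with indices in `S` change nothing. -/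
def ranksOff (S : Set (Fin N)) : Set ℤ :=
  {r | ∀ i ∈ S, (i : ℤ) ≠ r}

theorem agreeOn_apply {S : Set (Fin N)} {w : Equiv.Perm (Flag Q.Face)}
    (hw : w ∈ parabolic Q.flagSwap S) (Φ : Flag Q.Face) : AgreeOn (ranksOff S) (w Φ) Φ := by
  induction hw using Subgroup.closure_induction generalizing Φ with
  | mem w hw =>
    obtain ⟨i, hi, rfl⟩ := hw
    exact fun F hF => mem_flagSwap_iff (hF i hi).symm
  | one => exact fun F _ => Iff.rfl
  | mul a b _ _ iha ihb => exact (iha (b Φ)).trans (ihb Φ)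
  | inv a _ iha => simpa only [← Equiv.Perm.mul_apply, mul_inv_cancel, Equiv.Perm.one_apply] using
      (iha (a⁻¹ Φ)).symm

theorem exists_flagSwap_of_sectionFlag_adj {Φ : Flag Q.Face} {F G : Q.Face} {hF : F ∈ Φ}
    {hG : G ∈ Φ} {χ : Flag (Set.Icc F G)} {j : ℤ}
    (h : FlagAdjAt (fun H : Set.Icc F G => Q.rank H) j (sectionFlag Φ hF hG) χ) :
    ∃ i : Fin N, Q.rank F < i ∧ i < Q.rank G ∧ ∀ x ∈ χ, (x : Q.Face) ∈ Q.flagSwap i Φ := by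
  have hmono : StrictMono fun H : Set.Icc F G => Q.rank H := fun _ _ hlt => Q.rank_strictMono hlt
  obtain ⟨x, hxχ, hxΦ⟩ : ∃ x ∈ χ, (x : Q.Face) ∉ Φ := by
    by_contra! hsub
    exact h.1 (flag_eq_of_subset (Ψ := sectionFlag Φ hF hG) hsub).symm
  have hxj : Q.rank x = j := of_not_not fun hxj => hxΦ ((h.2 x hxj).2 hxχ)
  have hFx := Q.rank_strictMono (x.2.1.lt_of_ne fun hFx => hxΦ (by rwa [← hFx]))
  have hxG := Q.rank_strictMono (x.2.2.lt_of_ne fun hxG => hxΦ (by rwa [hxG]))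
  have hF1 := neg_one_le_rank F
  have hGN := rank_le G
  obtain ⟨i, rfl⟩ : ∃ i : Fin N, (i : ℤ) = j := ⟨⟨j.toNat, by lia⟩, Int.toNat_of_nonneg (by lia)⟩
  have hχ {M : Q.Face} (hM : M ∈ Φ) (hFM : Q.rank F ≤ Q.rank M) (hMG : Q.rank M ≤ Q.rank G)
      (hMi : Q.rank M ≠ i) : ⟨M, le_of_mem_flag hF hM hFM, le_of_mem_flag hM hG hMG⟩ ∈ χ :=
    (h.2 ⟨M, _⟩ hMi).1 hM
  refine ⟨i, by omega, by omega, fun y hy => ?_⟩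
  by_cases hyi : Q.rank y = i
  · rw [eq_of_mem_flag_of_strictMono hmono hy hxχ (hyi.trans hxj.symm)]
    obtain ⟨A, hA, -, -, B, hB, hAi, -, hBi⟩ := exists_mem_flag_near Φ i
    exact mem_flag_of_lt_of_lt (flagAdjAt_flagSwap i Φ) hA hB hAi hBi
      (lt_of_mem_flag_of_strictMono hmono (hχ hA (by omega) (by omega) (by omega)) hxχ
        (show Q.rank A < Q.rank x by omega))
      (lt_of_mem_flag_of_strictMono hmono hxχ (hχ hB (by omega) (by omega) (by omega))
        (show Q.rank x < Q.rank B by omega)) hxΦ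
  · exact (mem_flagSwap_iff hyi).2 ((h.2 y hyi).2 hy)

theorem exists_apply_agreeOn_Icc {Φ Ψ : Flag Q.Face} {F G : Q.Face} (hFG : F ≤ G) (hFΦ : F ∈ Φ)
    (hGΦ : G ∈ Φ) (hFΨ : F ∈ Ψ) (hGΨ : G ∈ Ψ) :
    ∃ w ∈ parabolic Q.flagSwap {i | Q.rank F < i ∧ i < Q.rank G},
      AgreeOn (Set.Icc (Q.rank F) (Q.rank G)) (w Φ) Ψ := by
  suffices ∀ χ, (flagGraph fun H : Set.Icc F G => Q.rank H).Reachable (sectionFlag Φ hFΦ hGΦ) χ →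
      ∃ w ∈ parabolic Q.flagSwap {i | Q.rank F < i ∧ i < Q.rank G},
        ∀ x ∈ χ, (x : Q.Face) ∈ w Φ by
    obtain ⟨w, hw, hwΦ⟩ := this (sectionFlag Ψ hFΨ hGΨ)
      ((Q.strongly_flag_connected F G hFG).preconnected _ _)
    exact ⟨w, hw, .symm <| .of_forall_mem fun H hH hr =>
      hwΦ ⟨H, le_of_mem_flag hFΨ hH hr.1, le_of_mem_flag hH hGΨ hr.2⟩ hH⟩
  intro χ hχ
  rw [SimpleGraph.reachable_iff_reflTransGen] at hχ
  induction hχ with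
  | refl => exact ⟨1, one_mem _, fun x hx => hx⟩
  | @tail χ χ' _ hadj ih =>
    obtain ⟨w, hw, hwχ⟩ := ih
    have hF : F ∈ w Φ := (agreeOn_apply hw Φ F fun i hi => hi.1.ne').2 hFΦ
    have hG : G ∈ w Φ := (agreeOn_apply hw Φ G fun i hi => hi.2.ne).2 hGΦ
    have hχ : χ = sectionFlag (w Φ) hF hG := flag_eq_of_subset hwχ
    obtain ⟨j, hj⟩ := hadj
    obtain ⟨i, hFi, hiG, hi⟩ := exists_flagSwap_of_sectionFlag_adj (hχ ▸ hj)
    exact ⟨Q.flagSwap i * w, mul_mem (mem_parabolic ⟨hFi, hiG⟩) hw, hi⟩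

theorem exists_mem_parabolic_apply_eq {S : Set (Fin N)} {Φ Ψ : Flag Q.Face}
    (h : AgreeOn (ranksOff S) Φ Ψ) : ∃ w ∈ parabolic Q.flagSwap S, w Φ = Ψ := by
  suffices ∀ m : ℕ, m ≤ N → ∀ Φ, AgreeOn (ranksOff S) Φ Ψ → AgreeOn (Set.Ici (m : ℤ)) Φ Ψ →
      ∃ w ∈ parabolic Q.flagSwap S, w Φ = Ψ by
    refine this N le_rfl Φ h (.of_forall_mem fun F hF hr => ?_)
    have hFtop : F = ⊤ := eq_of_mem_flag hF Φ.top_mem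
      ((rank_le F).antisymm hr |>.trans Q.rank_top.symm)
    exact hFtop ▸ Ψ.top_mem
  intro m
  induction m with
  | zero =>
    refine fun _ Φ _ hΦ => ⟨1, one_mem _, flag_eq_of_subset fun F hF => ?_⟩
    rcases (neg_one_le_rank F).eq_or_lt with hr | hr
    · exact eq_of_mem_flag hF Φ.bot_mem (hr.symm.trans Q.rank_bot.symm) ▸ Ψ.bot_mem
    · exact (hΦ F (by rw [Set.mem_Ici]; lia)).1 hF
  | succ m ih =>
    intro hmN Φ hΦ hΦm
    -- The swaps may change the ranks between `b - 1` and `m + 1`, where `b - 1` is not in `S`.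
    obtain ⟨b, hbm, hrun, hb⟩ := exists_maximal_run S (m + 1)
    obtain ⟨F, hF, hFb⟩ := exists_mem_flag_rank_eq Φ (i := (b : ℤ) - 1) (by lia) (by lia)
    obtain ⟨G, hG, hGm⟩ := exists_mem_flag_rank_eq Φ (i := (m : ℤ) + 1) (by lia) (by lia)
    have hF' : F ∈ Ψ := (hΦ F fun i hi hib => hb i hi (by omega)).1 hF
    have hG' : G ∈ Ψ := (hΦm G (by simp [hGm])).1 hG
    obtain ⟨w, hw, hwΨ⟩ :=
      exists_apply_agreeOn_Icc (le_of_mem_flag hF hG (by lia)) hF hG hF' hG'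
    have hsub : {i : Fin N | Q.rank F < i ∧ i < Q.rank G} ⊆ S := fun i ⟨hi1, hi2⟩ =>
      (hrun (by rw [mem_below]; omega)).resolve_left fun hi => by rw [mem_below] at hi; omega
    have hwS := parabolic_mono hsub hw
    obtain ⟨v, hv, hvΨ⟩ := ih (by lia) (w Φ) ((agreeOn_apply hwS Φ).trans hΦ) fun H hH => by
      rcases le_or_gt (Q.rank H) (m + 1) with hHm | hHm
      · exact hwΨ H ⟨by have := Set.mem_Ici.1 hH; lia, by lia⟩
      · exact (agreeOn_apply hw Φ H fun i hi hiH => by have := hi.2; lia).trans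
          (hΦm H (by simpa using hHm.le))
    exact ⟨v * w, mul_mem hv hwS, hvΨ⟩

theorem intersectionOn_flagSwap {L : Set (Fin N)}
    (hfree : ∀ w ∈ parabolic Q.flagSwap L, ∀ Φ, w Φ = Φ → w = 1) :
    IntersectionOn Q.flagSwap L := by
  rintro I hI J _ x ⟨hxI, hxJ⟩
  obtain ⟨Φ⟩ := (inferInstance : Nonempty (Flag Q.Face))
  have hagree : AgreeOn (ranksOff (I ∩ J)) Φ (x Φ) := fun F hF => by
    by_cases hFI : Q.rank F ∈ ranksOff I
    · exact (agreeOn_apply hxI Φ F hFI).symm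
    · refine (agreeOn_apply hxJ Φ F fun j hj hjF => hFI fun i hi hiF => ?_).symm
      have hij : i = j := Fin.ext (by lia)
      exact hF i ⟨hi, hij ▸ hj⟩ hiF
  obtain ⟨w, hw, hwΦ⟩ := exists_mem_parabolic_apply_eq hagree
  have hwx : w⁻¹ * x = 1 := by
    refine hfree _ (mul_mem (inv_mem (parabolic_mono (Set.inter_subset_left.trans hI) hw))
      (parabolic_mono hI hxI)) Φ ?_
    rw [Equiv.Perm.mul_apply, ← hwΦ, ← Equiv.Perm.mul_apply, inv_mul_cancel, Equiv.Perm.one_apply]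
  rwa [← inv_mul_eq_one.1 hwx]

end Connection

/-! ### Polytopes with isomorphic regular `k`-faces -/

section RegularFaces

variable {N : ℕ} {Q : AbstractPolytope.{u} N} {F G : Q.Face}

theorem rank_le_rank_of_strictMono {n m : ℤ} {P : AbstractPolytope.{u} n}
    {Q : AbstractPolytope.{v} m} {F : P.Face} {f : Set.Icc ⊥ F → Q.Face} (hf : StrictMono f)
    (x : Set.Icc ⊥ F) : P.rank x ≤ Q.rank (f x) := by
  obtain ⟨Φ, hΦ⟩ := Flag.exists_mem (x : P.Face)
  suffices ∀ r, -1 ≤ r → ∀ y : Set.Icc ⊥ F, (y : P.Face) ∈ Φ → P.rank y = r → r ≤ Q.rank (f y) from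
    this _ (neg_one_le_rank _) x hΦ rfl
  intro r hr
  induction r, hr using Int.leInduction with
  | base => exact fun y _ _ => neg_one_le_rank _
  | succ r hr ih =>
    intro y hy hyr
    have hyn := rank_le (y : P.Face)
    obtain ⟨z, hz, hzr⟩ := exists_mem_flag_rank_eq Φ hr (by lia)
    have hzy : z < y := lt_of_mem_flag hz hy (by lia)
    have hlt := Q.rank_strictMono
      (hf (show (⟨z, bot_le, hzy.le.trans y.2.2⟩ : Set.Icc ⊥ F) < y from hzy))
    have := ih ⟨z, bot_le, hzy.le.trans y.2.2⟩ hz hzr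
    lia

theorem rank_orderIso_apply (ε : Set.Icc ⊥ F ≃o Set.Icc ⊥ G) (x : Set.Icc ⊥ F) :
    Q.rank (ε x) = Q.rank x := by
  apply le_antisymm
  · simpa only [OrderIso.symm_apply_apply] using
      rank_le_rank_of_strictMono (f := fun y => (ε.symm y : Q.Face)) ε.symm.strictMono (ε x)
  · exact rank_le_rank_of_strictMono (f := fun y => (ε y : Q.Face)) ε.strictMono x

theorem rank_eq_of_orderIso (ε : Set.Icc ⊥ F ≃o Set.Icc ⊥ G) : Q.rank F = Q.rank G := by
  rw [← rank_orderIso_apply ε ⟨F, bot_le, le_rfl⟩,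
    ε.map_top' (y := ⟨G, bot_le, le_rfl⟩) (fun x => x.2.2) fun x => x.2.2]

/-- The isomorphism `ε` of the sections `F / ⊥` and `G / ⊥` takes the part of the flag `Φ` below `F`
to the part of the flag `Ψ` below `G`. -/
structure Corresp (ε : Set.Icc ⊥ F ≃o Set.Icc ⊥ G) (Φ Ψ : Flag Q.Face) : Prop where
  left_mem : F ∈ Φ
  right_mem : G ∈ Ψ
  mem_iff : ∀ x : Set.Icc ⊥ F, (x : Q.Face) ∈ Φ ↔ (ε x : Q.Face) ∈ Ψ

theorem Corresp.symm {ε : Set.Icc ⊥ F ≃o Set.Icc ⊥ G} {Φ Ψ : Flag Q.Face}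
    (h : Corresp ε Φ Ψ) : Corresp ε.symm Ψ Φ :=
  ⟨h.right_mem, h.left_mem, fun x => by rw [h.mem_iff, ε.apply_symm_apply]⟩

theorem Corresp.mem_flagSwap {ε : Set.Icc ⊥ F ≃o Set.Icc ⊥ G} {Φ Ψ : Flag Q.Face}
    (h : Corresp ε Φ Ψ) {i : Fin N} (hi : i < Q.rank F) {x : Set.Icc ⊥ F}
    (hx : (x : Q.Face) ∈ Q.flagSwap i Φ) : (ε x : Q.Face) ∈ Q.flagSwap i Ψ := by
  by_cases hxi : Q.rank x = i
  · obtain ⟨A, hA, -, -, B, hB, hAi, -, hBi⟩ := exists_mem_flag_near Φ i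
    let a : Set.Icc ⊥ F := ⟨A, bot_le, le_of_mem_flag hA h.left_mem (by omega)⟩
    let b : Set.Icc ⊥ F := ⟨B, bot_le, le_of_mem_flag hB h.left_mem (by omega)⟩
    have hax : a < x := lt_of_mem_flag (F := A) ((mem_flagSwap_iff (by omega)).2 hA) hx (by omega)
    have hxb : x < b := lt_of_mem_flag (G := B) hx ((mem_flagSwap_iff (by omega)).2 hB) (by omega)
    refine mem_flag_of_lt_of_lt (flagAdjAt_flagSwap i Ψ) ((h.mem_iff a).1 hA) ((h.mem_iff b).1 hB)
      ((rank_orderIso_apply ε a).trans hAi) ((rank_orderIso_apply ε b).trans hBi)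
      (ε.strictMono hax) (ε.strictMono hxb) ?_
    rw [← h.mem_iff]
    exact notMem_of_flagAdjAt (flagAdjAt_flagSwap i Φ).symm hx hxi
  · rw [mem_flagSwap_iff hxi, h.mem_iff] at hx
    rwa [mem_flagSwap_iff (by rwa [rank_orderIso_apply])]

theorem Corresp.flagSwap {ε : Set.Icc ⊥ F ≃o Set.Icc ⊥ G} {Φ Ψ : Flag Q.Face}
    (h : Corresp ε Φ Ψ) {i : Fin N} (hi : i < Q.rank F) :
    Corresp ε (Q.flagSwap i Φ) (Q.flagSwap i Ψ) := by
  have hi' : i < Q.rank G := by rwa [← rank_eq_of_orderIso ε]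
  refine ⟨(mem_flagSwap_iff hi.ne').2 h.left_mem, (mem_flagSwap_iff hi'.ne').2 h.right_mem,
    fun x => ⟨h.mem_flagSwap hi, fun hx => ?_⟩⟩
  simpa only [ε.symm_apply_apply] using h.symm.mem_flagSwap hi' hx

theorem corresp_apply_iff {ε : Set.Icc ⊥ F ≃o Set.Icc ⊥ G} {w : Equiv.Perm (Flag Q.Face)}
    (hw : w ∈ parabolic Q.flagSwap (below (Q.rank F))) (Φ Ψ : Flag Q.Face) :
    Corresp ε (w Φ) (w Ψ) ↔ Corresp ε Φ Ψ := by
  induction hw using Subgroup.closure_induction generalizing Φ Ψ with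
  | mem w hw =>
    obtain ⟨i, hi, rfl⟩ := hw
    refine ⟨fun h => ?_, fun h => h.flagSwap hi⟩
    simpa only [← Equiv.Perm.mul_apply, flagSwap_mul_self, Equiv.Perm.one_apply] using
      h.flagSwap hi
  | one => exact Iff.rfl
  | mul a b _ _ iha ihb => exact (iha (b Φ) (b Ψ)).trans (ihb Φ Ψ)
  | inv a _ iha =>
    simpa only [← Equiv.Perm.mul_apply, mul_inv_cancel, Equiv.Perm.one_apply] using
      (iha (a⁻¹ Φ) (a⁻¹ Ψ)).symm

theorem exists_corresp {k : ℤ} {K : AbstractPolytope.{v} k} (hK : K.IsRegular)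
    (hQ : Q.AllFacesIso k K) (hFk : Q.rank F = k) (hGk : Q.rank G = k) {Φ Ψ : Flag Q.Face}
    (hF : F ∈ Φ) (hG : G ∈ Ψ) : ∃ ε : Set.Icc ⊥ F ≃o Set.Icc ⊥ G, Corresp ε Φ Ψ := by
  obtain ⟨δF⟩ := hQ F hFk
  obtain ⟨δG⟩ := hQ G hGk
  obtain ⟨γ, hγ⟩ := hK (Flag.map δF (sectionFlag Φ Φ.bot_mem hF))
    (Flag.map δG (sectionFlag Ψ Ψ.bot_mem hG))
  refine ⟨δF.trans (γ.trans δG.symm), hF, hG, fun x => ?_⟩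
  calc (x : Q.Face) ∈ Φ ↔ γ (δF x) ∈ Flag.map γ (Flag.map δF (sectionFlag Φ Φ.bot_mem hF)) := by
        rw [apply_mem_flag_map, apply_mem_flag_map, mem_sectionFlag]
    _ ↔ δG (δG.symm (γ (δF x))) ∈ Flag.map δG (sectionFlag Ψ Ψ.bot_mem hG) := by
        rw [hγ, δG.apply_symm_apply]
    _ ↔ (δG.symm (γ (δF x)) : Q.Face) ∈ Ψ := by rw [apply_mem_flag_map, mem_sectionFlag]

/-- Any two flags correspond below rank `k`, so that an element of `⟨s₀, …, sₖ₋₁⟩` that fixes one of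
them fixes the other. -/
theorem eq_one_of_apply_eq {k : ℤ} {K : AbstractPolytope.{v} k} (hk1 : -1 ≤ k) (hkN : k ≤ N)
    (hK : K.IsRegular) (hQ : Q.AllFacesIso k K) {w : Equiv.Perm (Flag Q.Face)}
    (hw : w ∈ parabolic Q.flagSwap (below k)) {Φ : Flag Q.Face} (h : w Φ = Φ) : w = 1 := by
  refine Equiv.ext fun Ψ => ?_
  obtain ⟨F, hF, rfl⟩ := exists_mem_flag_rank_eq Φ hk1 hkN
  obtain ⟨G, hG, hGF⟩ := exists_mem_flag_rank_eq Ψ hk1 hkN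
  obtain ⟨ε, hε⟩ := exists_corresp hK hQ rfl hGF hF hG
  have hε' := (corresp_apply_iff hw Φ Ψ).2 hε
  rw [h] at hε'
  refine flag_eq_of_subset fun H hH => ?_
  rcases le_total (Q.rank H) (Q.rank F) with hHF | hFH
  · let x : Set.Icc ⊥ G := ⟨H, bot_le, le_of_mem_flag hH hε'.right_mem (by lia)⟩
    have hx := (hε'.symm.mem_iff x).1 hH
    exact (hε.symm.mem_iff x).2 hx
  · exact (agreeOn_apply hw Ψ H fun i hi => (hi.trans_le hFH).ne).1 hH

end RegularFaces

end AbstractPolytope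

/-! ### The polytope of a string C-group -/

section CosetPolytope

variable {Γ : Type u} [Group Γ] {N : ℕ} {γ : Fin N → Γ}

/-- The stabilizer of the base `j`-face in the coset geometry of the group with generators `γ`. For
`j = -1` and `j = N` it contains all generators. -/
def faceStabilizer (γ : Fin N → Γ) (j : ℤ) : Subgroup Γ :=
  parabolic γ {i | (i : ℤ) ≠ j}

/-- The faces of the coset geometry of an sggi: the faces of rank `j` are the left cosets of the
stabilizer of the base `j`-face. The sggi conditions are carried along since incidence is
transitive only because of them. -/
def CosetFace (_hγ : IsSggi γ) : Type u :=
  Σ j : Set.Icc (-1 : ℤ) N, Γ ⧸ faceStabilizer γ j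

namespace CosetFace

variable {hγ : IsSggi γ} {F G : CosetFace hγ} {x y : Γ}

instance [Finite Γ] : Finite (CosetFace hγ) :=
  inferInstanceAs (Finite (Σ j : Set.Icc (-1 : ℤ) N, Γ ⧸ faceStabilizer γ j))

instance : MulAction Γ (CosetFace hγ) :=
  inferInstanceAs (MulAction Γ (Σ j : Set.Icc (-1 : ℤ) N, Γ ⧸ faceStabilizer γ j))

instance : Membership Γ (CosetFace hγ) :=
  ⟨fun F x => (x : Γ ⧸ faceStabilizer γ F.1) = F.2⟩

/-- The rank of a face of the coset geometry. -/
def rank (F : CosetFace hγ) : ℤ :=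
  F.1

theorem neg_one_le_rank (F : CosetFace hγ) : -1 ≤ F.rank :=
  F.1.2.1

theorem rank_le (F : CosetFace hγ) : F.rank ≤ N :=
  F.1.2.2

theorem exists_mem (F : CosetFace hγ) : ∃ x, x ∈ F :=
  QuotientGroup.mk_surjective F.2

theorem exists_rank_eq (hγ : IsSggi γ) (x : Γ) {j : ℤ} (h1 : -1 ≤ j) (h2 : j ≤ N) :
    ∃ F : CosetFace hγ, F.rank = j ∧ x ∈ F :=
  ⟨⟨⟨j, h1, h2⟩, (x : Γ ⧸ faceStabilizer γ j)⟩, rfl, rfl⟩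

theorem mem_iff_of_mem (hx : x ∈ F) : y ∈ F ↔ x⁻¹ * y ∈ faceStabilizer γ F.rank := by
  rw [← SetLike.mem_coe, rank, SetLike.mem_coe, ← QuotientGroup.eq, show (x : Γ ⧸ _) = F.2 from hx]
  exact eq_comm

theorem mul_mem_iff (hy : y ∈ faceStabilizer γ F.rank) : x * y ∈ F ↔ x ∈ F := by
  refine ⟨fun h => ?_, fun h => ?_⟩
  · rw [mem_iff_of_mem h]
    simpa using hy
  · rw [mem_iff_of_mem h]
    simpa using hy

theorem eq_of_mem (hF : x ∈ F) (hG : x ∈ G) (h : F.rank = G.rank) : F = G := by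
  obtain ⟨i, F⟩ := F
  obtain ⟨j, G⟩ := G
  obtain rfl : i = j := Subtype.ext h
  exact congrArg (Sigma.mk i) (hF.symm.trans hG)

theorem smul_mem_smul (y : Γ) (h : x ∈ F) : y * x ∈ y • F :=
  congrArg (y • ·) h

/-- A face of lower rank is incident with a face of higher rank if the two cosets intersect. -/
instance : LE (CosetFace hγ) :=
  ⟨fun F G => F.rank ≤ G.rank ∧ ∃ x, x ∈ F ∧ x ∈ G⟩

theorem le_of_mem (hF : x ∈ F) (hG : x ∈ G) (h : F.rank ≤ G.rank) : F ≤ G :=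
  ⟨h, x, hF, hG⟩

theorem exists_mem_of_mem_of_mem (hx : x ∈ F) (hy : y ∈ F) :
    ∃ z, (∀ G : CosetFace hγ, G.rank ≤ F.rank → x ∈ G → z ∈ G) ∧
      ∀ G : CosetFace hγ, F.rank ≤ G.rank → y ∈ G → z ∈ G := by
  obtain ⟨a, ha, b, hb, hab⟩ := hγ.exists_mul (fun _ hi => hi) ((mem_iff_of_mem hy).1 hx)
  have hz : y * a = x * b⁻¹ := by rw [eq_mul_inv_iff_mul_eq, mul_assoc, hab, mul_inv_cancel_left]
  refine ⟨y * a, fun G hGF hG => ?_, fun G hFG hG => ?_⟩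
  · rw [hz]
    exact (mul_mem_iff (inv_mem (parabolic_mono (fun i hi => (hGF.trans_lt hi.2).ne') hb))).2 hG
  · exact (mul_mem_iff (parabolic_mono (fun i hi => (hi.2.trans_le hFG).ne) ha)).2 hG

theorem exists_common_mem_of_le {H : CosetFace hγ} (hFG : F ≤ G) (hGH : G ≤ H) :
    ∃ z, z ∈ F ∧ z ∈ G ∧ z ∈ H := by
  obtain ⟨hFG, x, hxF, hxG⟩ := hFG
  obtain ⟨hGH, y, hyG, hyH⟩ := hGH
  obtain ⟨z, hxz, hyz⟩ := exists_mem_of_mem_of_mem hxG hyG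
  exact ⟨z, hxz F hFG hxF, hxz G le_rfl hxG, hyz H hGH hyH⟩

instance : PartialOrder (CosetFace hγ) where
  le_refl F := let ⟨_, hx⟩ := F.exists_mem; le_of_mem hx hx le_rfl
  le_trans _ _ _ hFG hGH :=
    let ⟨_, hF, _, hH⟩ := exists_common_mem_of_le hFG hGH
    le_of_mem hF hH (hFG.1.trans hGH.1)
  le_antisymm _ _ hFG hGF := let ⟨_, _, hF, hG⟩ := hFG; eq_of_mem hF hG (hFG.1.antisymm hGF.1)

theorem lt_of_mem (hF : x ∈ F) (hG : x ∈ G) (h : F.rank < G.rank) : F < G :=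
  (le_of_mem hF hG h.le).lt_of_ne fun hFG => h.ne (congrArg rank hFG)

theorem rank_strictMono : StrictMono (rank : CosetFace hγ → ℤ) := fun F G hFG => by
  obtain ⟨hr, x, hxF, hxG⟩ := hFG.le
  exact hr.lt_of_ne fun hr => hFG.ne (eq_of_mem hxF hxG hr)

theorem mem_of_isImproper (h : F.rank = -1 ∨ F.rank = N) (x : Γ) : x ∈ F := by
  have htop : faceStabilizer γ F.rank = ⊤ := by
    have hall : {i : Fin N | (i : ℤ) ≠ F.rank} = Set.univ :=
      Set.eq_univ_of_forall fun i => show (i : ℤ) ≠ F.rank by omega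
    rw [faceStabilizer, hall, parabolic, Set.image_univ, hγ.closure_eq_top]
  obtain ⟨y, hy⟩ := F.exists_mem
  rw [mem_iff_of_mem hy, htop]
  exact Subgroup.mem_top _

theorem le_of_rank_le (h : F ≤ G ∨ G ≤ F) (hr : F.rank ≤ G.rank) : F ≤ G :=
  h.elim id fun ⟨_, _, hG, hF⟩ => le_of_mem hF hG hr

theorem exists_common_mem_of_finset (t : Finset (CosetFace hγ))
    (ht : IsChain (· ≤ ·) (t : Set (CosetFace hγ))) (G : CosetFace hγ) (hG : ∀ F ∈ t, F ≤ G) :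
    ∃ x ∈ G, ∀ F ∈ t, x ∈ F := by
  classical
  revert ht G
  refine Finset.induction_on_max_value rank t ?_ fun F t _ hmax ih ht G hG => ?_
  · exact fun _ G _ => let ⟨x, hx⟩ := G.exists_mem; ⟨x, hx, by simp⟩
  rw [Finset.coe_insert] at ht
  obtain ⟨x, hxF, hx⟩ := ih (ht.mono (Set.subset_insert _ _)) F fun H hH =>
    le_of_rank_le (ht.total (Set.mem_insert_of_mem _ hH) (Set.mem_insert _ _)) (hmax H hH)
  obtain ⟨hFG, y, hyF, hyG⟩ := hG F (Finset.mem_insert_self F t)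
  obtain ⟨z, hxz, hyz⟩ := exists_mem_of_mem_of_mem hxF hyF
  refine ⟨z, hyz G hFG hyG, fun H hH => ?_⟩
  rcases Finset.mem_insert.1 hH with rfl | hH
  · exact hxz H le_rfl hxF
  · exact hxz H (hmax H hH) (hx H hH)

theorem exists_common_mem_of_isChain {s : Set (CosetFace hγ)} (hs : IsChain (· ≤ ·) s) :
    ∃ x, ∀ F ∈ s, x ∈ F := by
  have hfin : s.Finite := by
    refine Set.Finite.of_finite_image (f := Sigma.fst) (Set.toFinite _) fun F hF G hG hFG => ?_
    have hr : F.rank = G.rank := congrArg Subtype.val hFG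
    exact (le_of_rank_le (hs.total hF hG) hr.le).antisymm (le_of_rank_le (hs.total hG hF) hr.ge)
  obtain ⟨T, hT, -⟩ := exists_rank_eq hγ 1 (j := N) (by lia) le_rfl
  have hle (F : CosetFace hγ) : F ≤ T :=
    let ⟨x, hx⟩ := F.exists_mem
    le_of_mem hx (mem_of_isImproper (.inr hT) x) (hT ▸ F.rank_le)
  obtain ⟨x, -, hx⟩ :=
    exists_common_mem_of_finset hfin.toFinset (by rwa [hfin.coe_toFinset]) T fun F _ => hle F
  exact ⟨x, fun F hF => hx F (hfin.mem_toFinset.2 hF)⟩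

instance : BoundedOrder (CosetFace hγ) where
  bot := ⟨⟨-1, le_rfl, by lia⟩, ((1 : Γ) : Γ ⧸ faceStabilizer γ (-1))⟩
  bot_le F := let ⟨x, hx⟩ := F.exists_mem
    le_of_mem (mem_of_isImproper (.inl rfl) x) hx F.neg_one_le_rank
  top := ⟨⟨N, by lia, le_rfl⟩, ((1 : Γ) : Γ ⧸ faceStabilizer γ N)⟩
  le_top F := let ⟨x, hx⟩ := F.exists_mem
    le_of_mem hx (mem_of_isImproper (.inr rfl) x) F.rank_le

/-- The flag of all cosets that contain `x`. -/
def flagThrough (hγ : IsSggi γ) (x : Γ) : Flag (CosetFace hγ) where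
  carrier := {F | x ∈ F}
  Chain' F hF G hG _ := (le_total F.rank G.rank).imp (le_of_mem hF hG) (le_of_mem hG hF)
  max_chain' s hs hsub := hsub.antisymm fun F hF => by
    obtain ⟨G, hGF, hxG⟩ := exists_rank_eq hγ x F.neg_one_le_rank F.rank_le
    have hFG := hs.total hF (hsub hxG)
    rwa [(le_of_rank_le hFG hGF.ge).antisymm (le_of_rank_le hFG.symm hGF.le)]

theorem mem_flagThrough : F ∈ flagThrough hγ x ↔ x ∈ F :=
  Iff.rfl

theorem exists_eq_flagThrough (Φ : Flag (CosetFace hγ)) : ∃ x, Φ = flagThrough hγ x :=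
  let ⟨x, hx⟩ := exists_common_mem_of_isChain Φ.chain_le
  ⟨x, flag_eq_of_subset hx⟩

theorem exists_eq_sectionFlag (hFG : F ≤ G) (χ : Flag (Set.Icc F G)) :
    ∃ (x : Γ) (hF : x ∈ F) (hG : x ∈ G), χ = sectionFlag (flagThrough hγ x) hF hG := by
  obtain ⟨x, hx⟩ := exists_common_mem_of_isChain
    (χ.chain_le.image_of_map_rel _ _ (fun H : Set.Icc F G => (H : CosetFace hγ)) fun _ _ h => h)
  rw [Set.forall_mem_image] at hx
  refine ⟨x, hx (x := ⟨F, le_rfl, hFG⟩) ?_, hx (x := ⟨G, hFG, le_rfl⟩) ?_,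
    flag_eq_of_subset fun H hH => hx hH⟩
  · exact Flag.mem_iff_forall_le_or_ge.2 fun H _ => .inl H.2.1
  · exact Flag.mem_iff_forall_le_or_ge.2 fun H _ => .inr H.2.2

theorem mul_generator_mem_iff {i : Fin N} (hi : F.rank ≠ i) : x * γ i ∈ F ↔ x ∈ F :=
  mul_mem_iff (mem_parabolic hi.symm)

theorem rank_eq_of_covBy (hFG : F ⋖ G) : G.rank = F.rank + 1 := by
  obtain ⟨-, x, hxF, hxG⟩ := hFG.le
  have hlt := rank_strictMono hFG.lt
  have hF := F.neg_one_le_rank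
  have hG := G.rank_le
  obtain ⟨H, hH, hxH⟩ := exists_rank_eq hγ x (j := F.rank + 1) (by lia) (by lia)
  by_contra! hne
  exact hFG.2 (lt_of_mem hxF hxH (by lia)) (lt_of_mem hxH hxG (by lia))

theorem reachable_sectionFlag_mul_generator {i : Fin N} (hF : x ∈ F) (hG : x ∈ G)
    (hF' : x * γ i ∈ F) (hG' : x * γ i ∈ G) :
    (flagGraph fun H : Set.Icc F G => rank H.1).Reachable (sectionFlag (flagThrough hγ x) hF hG)
      (sectionFlag (flagThrough hγ (x * γ i)) hF' hG') := by
  by_cases heq : sectionFlag (flagThrough hγ x) hF hG =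
      sectionFlag (flagThrough hγ (x * γ i)) hF' hG'
  · rw [heq]
  · exact SimpleGraph.Adj.reachable ⟨i, heq, fun H hH => (mul_generator_mem_iff hH).symm⟩

theorem reachable_sectionFlag {w : Γ}
    (hw : w ∈ parabolic γ ({i | (i : ℤ) ≠ F.rank} ∩ {i | (i : ℤ) ≠ G.rank})) (hF : x ∈ F)
    (hG : x ∈ G) (hF' : x * w ∈ F) (hG' : x * w ∈ G) :
    (flagGraph fun H : Set.Icc F G => rank H.1).Reachable (sectionFlag (flagThrough hγ x) hF hG)
      (sectionFlag (flagThrough hγ (x * w)) hF' hG') := by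
  induction hw using Subgroup.closure_induction_right with
  | one => simp only [mul_one, SimpleGraph.Reachable.rfl]
  | mul_right w _ s hs ih =>
    obtain ⟨i, ⟨hiF, hiG⟩, rfl⟩ := hs
    simp only [← mul_assoc] at hF' hG' ⊢
    exact (ih ((mul_generator_mem_iff hiF.symm).1 hF')
      ((mul_generator_mem_iff hiG.symm).1 hG')).trans
      (reachable_sectionFlag_mul_generator _ _ _ _)
  | mul_inv_cancel w _ s hs ih =>
    obtain ⟨i, ⟨hiF, hiG⟩, rfl⟩ := hs
    simp only [inv_eq_of_mul_eq_one_right (hγ.mul_self i), ← mul_assoc] at hF' hG' ⊢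
    exact (ih ((mul_generator_mem_iff hiF.symm).1 hF')
      ((mul_generator_mem_iff hiG.symm).1 hG')).trans
      (reachable_sectionFlag_mul_generator _ _ _ _)

theorem connected_flagGraph (hγ : IsStringCGroup γ) {F G : CosetFace hγ.toIsSggi} (hFG : F ≤ G) :
    (flagGraph fun H : Set.Icc F G => rank H.1).Connected where
  preconnected χ χ' := by
    obtain ⟨x, hF, hG, rfl⟩ := exists_eq_sectionFlag hFG χ
    obtain ⟨y, hF', hG', rfl⟩ := exists_eq_sectionFlag hFG χ'
    obtain ⟨w, rfl⟩ : ∃ w, y = x * w := ⟨x⁻¹ * y, (mul_inv_cancel_left x y).symm⟩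
    refine reachable_sectionFlag ?_ hF hG hF' hG'
    rw [parabolic, ← hγ.inter_eq]
    rw [mem_iff_of_mem hF, inv_mul_cancel_left] at hF'
    rw [mem_iff_of_mem hG, inv_mul_cancel_left] at hG'
    exact ⟨hF', hG'⟩
  nonempty := inferInstance

theorem mul_generator_notMem (hγ : IsStringCGroup γ) {F : CosetFace hγ.toIsSggi} {i : Fin N}
    (hx : x ∈ F) (hi : F.rank = i) : x * γ i ∉ F := fun h => by
  rw [mem_iff_of_mem hx, inv_mul_cancel_left, hi] at h
  have hmem : γ i ∈ Subgroup.closure (γ '' ({i} ∩ {j | (j : ℤ) ≠ i})) := by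
    rw [← hγ.inter_eq]
    exact ⟨mem_parabolic rfl, h⟩
  rw [show ({i} ∩ {j : Fin N | (j : ℤ) ≠ i}) = ∅ from
    Set.disjoint_iff_inter_eq_empty.1 (Set.disjoint_singleton_left.2 fun h => h rfl),
    Set.image_empty, Subgroup.closure_empty, Subgroup.mem_bot] at hmem
  exact hγ.ne_one i hmem

theorem mem_or_mul_generator_mem (hγ : IsStringCGroup γ) {F H G : CosetFace hγ.toIsSggi}
    {i : Fin N} (hFx : x ∈ F) (hGx : x ∈ G) (hF : F.rank = i - 1) (hH : H.rank = i)
    (hG : G.rank = i + 1) (hFH : F ≤ H) (hHG : H ≤ G) : x ∈ H ∨ x * γ i ∈ H := by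
  obtain ⟨z, hFz, hHz, hGz⟩ := exists_common_mem_of_le hFH hHG
  have hxz : x⁻¹ * z ∈ parabolic γ ({i} ∪ {j : Fin N | (i : ℕ) + 1 < j ∨ (j : ℕ) + 1 < i}) := by
    have hmem : x⁻¹ * z ∈ parabolic γ ({i | (i : ℤ) ≠ F.rank} ∩ {i | (i : ℤ) ≠ G.rank}) := by
      rw [parabolic, ← hγ.inter_eq]
      exact ⟨(mem_iff_of_mem hFx).1 hFz, (mem_iff_of_mem hGx).1 hGz⟩
    refine parabolic_mono (fun j hj => ?_) hmem
    simp only [Set.mem_inter_iff, Set.mem_ofPred_eq, hF, hG] at hj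
    simp only [Set.mem_union, Set.mem_singleton_iff, Fin.ext_iff, Set.mem_ofPred_eq]
    omega
  obtain ⟨a, ha, b, hb, hab⟩ := exists_mul_of_mem_parabolic_union (by
    rintro _ rfl j (hj | hj)
    exacts [hγ.commute hj, (hγ.commute hj).symm]) hxz
  have hxa : x * a ∈ H := by
    have hsub : {j : Fin N | (i : ℕ) + 1 < j ∨ (j : ℕ) + 1 < i} ⊆ {j | (j : ℤ) ≠ H.rank} :=
      fun j hj => by simp only [Set.mem_ofPred_eq, hH] at hj ⊢; omega
    have hb' : b ∈ faceStabilizer γ H.rank := parabolic_mono hsub hb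
    rwa [← mul_mem_iff hb', mul_assoc, hab, mul_inv_cancel_left]
  rcases hγ.eq_one_or_eq_of_mem_parabolic_singleton ha with rfl | rfl
  · exact .inl (by rwa [mul_one] at hxa)
  · exact .inr hxa

theorem ncard_Ioo (hγ : IsStringCGroup γ) {F G : CosetFace hγ.toIsSggi} (hFG : F < G)
    (hr : G.rank = F.rank + 2) : (Set.Ioo F G).ncard = 2 := by
  obtain ⟨-, x, hxF, hxG⟩ := hFG.le
  have hF1 := F.neg_one_le_rank
  have hGN := G.rank_le
  obtain ⟨i, hi⟩ : ∃ i : Fin N, (i : ℤ) = F.rank + 1 :=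
    ⟨⟨(F.rank + 1).toNat, by lia⟩, Int.toNat_of_nonneg (by lia)⟩
  obtain ⟨H, hH, hxH⟩ := exists_rank_eq hγ.toIsSggi x (j := i) (by lia) (by lia)
  obtain ⟨H', hH', hxH'⟩ := exists_rank_eq hγ.toIsSggi (x * γ i) (j := i) (by lia) (by lia)
  have hne : H ≠ H' := by
    rintro rfl
    exact mul_generator_notMem hγ hxH hH hxH'
  rw [Set.ncard_eq_two]
  refine ⟨H, H', hne, Set.ext fun M => ⟨fun hM => ?_, ?_⟩⟩
  · have hFM := rank_strictMono hM.1
    have hMG := rank_strictMono hM.2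
    exact (mem_or_mul_generator_mem hγ (i := i) hxF hxG (by lia) (by lia) (by lia) hM.1.le
      hM.2.le).imp (fun h => eq_of_mem h hxH (by lia)) fun h => eq_of_mem h hxH' (by lia)
  · rintro (rfl | rfl)
    · exact ⟨lt_of_mem hxF hxH (by lia), lt_of_mem hxH hxG (by lia)⟩
    · exact ⟨lt_of_mem ((mul_generator_mem_iff (by lia)).2 hxF) hxH' (by lia),
        lt_of_mem hxH' ((mul_generator_mem_iff (by lia)).2 hxG) (by lia)⟩

theorem flagAdjAt_flagThrough (hγ : IsStringCGroup γ) (x : Γ) (i : Fin N) :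
    FlagAdjAt rank i (flagThrough hγ.toIsSggi x) (flagThrough hγ.toIsSggi (x * γ i)) := by
  refine ⟨fun heq => ?_, fun F hF => (mul_generator_mem_iff hF).symm⟩
  obtain ⟨F, hF, hxF⟩ := exists_rank_eq hγ.toIsSggi x (j := i) (by omega) (by omega)
  refine mul_generator_notMem hγ hxF hF ?_
  rwa [← mem_flagThrough, ← heq]

theorem smul_le_smul_iff (y : Γ) : y • F ≤ y • G ↔ F ≤ G := by
  refine ⟨fun ⟨hr, x, hF, hG⟩ => ⟨hr, y⁻¹ * x, ?_, ?_⟩, fun ⟨hr, x, hF, hG⟩ =>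
    ⟨hr, y * x, smul_mem_smul y hF, smul_mem_smul y hG⟩⟩
  · simpa only [inv_smul_smul] using smul_mem_smul y⁻¹ hF
  · simpa only [inv_smul_smul] using smul_mem_smul y⁻¹ hG

end CosetFace

/-- The regular polytope whose group is the given string C-group: its faces are the cosets of the
stabilizers of the base faces. -/
def cosetPolytope (hγ : IsStringCGroup γ) : AbstractPolytope.{u} N where
  Face := CosetFace hγ.toIsSggi
  rank := CosetFace.rank
  rank_strictMono := CosetFace.rank_strictMono
  rank_covBy _ _ := CosetFace.rank_eq_of_covBy
  rank_bot := rfl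
  rank_top := rfl
  diamond _ _ := CosetFace.ncard_Ioo hγ
  strongly_flag_connected _ _ := CosetFace.connected_flagGraph hγ

theorem isRegular_cosetPolytope (hγ : IsStringCGroup γ) : (cosetPolytope hγ).IsRegular := by
  intro Φ Ψ
  obtain ⟨x, rfl⟩ := CosetFace.exists_eq_flagThrough Φ
  obtain ⟨y, rfl⟩ := CosetFace.exists_eq_flagThrough Ψ
  let σ : CosetFace hγ.toIsSggi ≃o CosetFace hγ.toIsSggi :=
    ⟨MulAction.toPerm (y * x⁻¹), CosetFace.smul_le_smul_iff (y * x⁻¹)⟩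
  have hσ (F : CosetFace hγ.toIsSggi) (hF : x ∈ F) : y ∈ (y * x⁻¹) • F := by
    simpa only [inv_mul_cancel_right] using CosetFace.smul_mem_smul (y * x⁻¹) hF
  refine ⟨σ, flag_eq_of_subset ?_⟩
  rintro _ ⟨F, hF, rfl⟩
  exact hσ F hF

end CosetPolytope

/-! ### Coverings by coset polytopes -/

section CosetCovering

open AbstractPolytope CosetFace

variable {Γ : Type u} [Group Γ] {N : ℕ} {γ : Fin N → Γ} {Q : AbstractPolytope.{u} N}
  {ψ : Γ →* Equiv.Perm (Flag Q.Face)} {x y : Γ}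

theorem map_parabolic_flagSwap (hψ : ∀ i, ψ (γ i) = Q.flagSwap i) (I : Set (Fin N)) :
    (parabolic γ I).map ψ = parabolic Q.flagSwap I := by
  rw [map_parabolic, show ψ ∘ γ = Q.flagSwap from funext hψ]

theorem agreeOn_of_inv_mul_mem (hψ : ∀ i, ψ (γ i) = Q.flagSwap i) (Φ₀ : Flag Q.Face) {r : ℤ}
    (h : x⁻¹ * y ∈ faceStabilizer γ r) : AgreeOn {r} (ψ x⁻¹ Φ₀) (ψ y⁻¹ Φ₀) := by
  have hxy : ψ (x⁻¹ * y) ∈ parabolic Q.flagSwap {i | (i : ℤ) ≠ r} := by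
    rw [← map_parabolic_flagSwap hψ]
    exact Subgroup.mem_map_of_mem ψ h
  have hΦ : ψ (x⁻¹ * y) (ψ y⁻¹ Φ₀) = ψ x⁻¹ Φ₀ := by
    rw [← Equiv.Perm.mul_apply, ← map_mul, mul_inv_cancel_right]
  rw [← hΦ]
  exact (agreeOn_apply hxy _).mono (Set.singleton_subset_iff.2 fun i hi => hi)

/-- The covering of `Q` by the coset geometry of `Γ`, where `Γ` acts on the flags of `Q` through the
connection group: the flag of all cosets that contain `x` goes to `x⁻¹ Φ₀`. -/
noncomputable def cosetProj (hγ : IsSggi γ) (ψ : Γ →* Equiv.Perm (Flag Q.Face)) (Φ₀ : Flag Q.Face)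
    (F : CosetFace hγ) : Q.Face :=
  (exists_mem_flag_rank_eq (ψ F.exists_mem.choose⁻¹ Φ₀) F.neg_one_le_rank F.rank_le).choose

variable {hγ : IsSggi γ} {Φ₀ : Flag Q.Face} {F G : CosetFace hγ}

theorem rank_cosetProj : Q.rank (cosetProj hγ ψ Φ₀ F) = F.rank :=
  (exists_mem_flag_rank_eq (ψ F.exists_mem.choose⁻¹ Φ₀) F.neg_one_le_rank F.rank_le).choose_spec.2

theorem cosetProj_mem (hψ : ∀ i, ψ (γ i) = Q.flagSwap i) (hx : x ∈ F) :
    cosetProj hγ ψ Φ₀ F ∈ ψ x⁻¹ Φ₀ :=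
  (agreeOn_of_inv_mul_mem hψ Φ₀ ((mem_iff_of_mem F.exists_mem.choose_spec).1 hx) _ rank_cosetProj).1
    (exists_mem_flag_rank_eq _ F.neg_one_le_rank F.rank_le).choose_spec.1

theorem exists_cosetProj_eq (hψ : ∀ i, ψ (γ i) = Q.flagSwap i) {H : Q.Face}
    (hH : H ∈ ψ x⁻¹ Φ₀) : ∃ F : CosetFace hγ, x ∈ F ∧ cosetProj hγ ψ Φ₀ F = H := by
  obtain ⟨F, hF, hxF⟩ := exists_rank_eq hγ x (AbstractPolytope.neg_one_le_rank H)
    (AbstractPolytope.rank_le H)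
  exact ⟨F, hxF, eq_of_mem_flag (cosetProj_mem hψ hxF) hH (rank_cosetProj.trans hF)⟩

theorem coe_eq_image_flagThrough (hψ : ∀ i, ψ (γ i) = Q.flagSwap i) (x : Γ) :
    (ψ x⁻¹ Φ₀ : Set Q.Face) = cosetProj hγ ψ Φ₀ '' flagThrough hγ x := by
  refine Set.Subset.antisymm (fun H hH => exists_cosetProj_eq hψ hH) ?_
  rintro _ ⟨F, hF, rfl⟩
  exact cosetProj_mem hψ hF

theorem monotone_cosetProj (hψ : ∀ i, ψ (γ i) = Q.flagSwap i) :
    Monotone (cosetProj hγ ψ Φ₀) := fun F G ⟨hr, x, hF, hG⟩ =>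
  le_of_mem_flag (cosetProj_mem hψ hF) (cosetProj_mem hψ hG)
    (by rwa [rank_cosetProj, rank_cosetProj])

theorem isCovering_cosetProj (hγ : IsStringCGroup γ) (hψ : ∀ i, ψ (γ i) = Q.flagSwap i) :
    IsCovering (cosetPolytope hγ) Q (cosetProj hγ.toIsSggi ψ Φ₀) where
  monotone := monotone_cosetProj hψ
  rank_eq _ := rank_cosetProj
  adjacent j Φ Ψ hadj := by
    obtain ⟨i, rfl⟩ := exists_fin_of_flagAdjAt hadj
    obtain ⟨x, rfl⟩ := exists_eq_flagThrough Φ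
    obtain rfl : Ψ = flagThrough hγ.toIsSggi (x * γ i) :=
      flagAdjAt_unique hadj (flagAdjAt_flagThrough hγ x i)
    refine ⟨_, _, coe_eq_image_flagThrough hψ x, coe_eq_image_flagThrough hψ (x * γ i), ?_⟩
    rw [mul_inv_rev, map_mul, Equiv.Perm.mul_apply, map_inv ψ (γ i), hψ,
      inv_eq_of_mul_eq_one_right (flagSwap_mul_self i)]
    exact flagAdjAt_flagSwap i _

theorem exists_mem_of_isChain (hψ : ∀ i, ψ (γ i) = Q.flagSwap i) {C : Set Q.Face}
    (hC : IsChain (· ≤ ·) C) (hCF : ∀ H ∈ C, H ≤ cosetProj hγ ψ Φ₀ F) :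
    ∃ z ∈ F, ∀ H ∈ C, H ∈ ψ z⁻¹ Φ₀ := by
  obtain ⟨x, hx⟩ := F.exists_mem
  have hle {H M : Q.Face} (hH : H ∈ C) (hM : M ∈ ψ x⁻¹ Φ₀) (hFM : F.rank ≤ Q.rank M) : H ≤ M :=
    (hCF H hH).trans (le_of_mem_flag (cosetProj_mem hψ hx) hM (rank_cosetProj.trans_le hFM))
  have hchain : IsChain (· ≤ ·) (C ∪ {M | M ∈ ψ x⁻¹ Φ₀ ∧ F.rank ≤ Q.rank M}) := by
    rintro H (hH | hH) M (hM | hM) hne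
    · exact hC hH hM hne
    · exact .inl (hle hH hM.1 hM.2)
    · exact .inr (hle hM hH.1 hH.2)
    · exact Flag.le_or_le _ hH.1 hM.1
  obtain ⟨Ψ, hΨ⟩ := hchain.exists_subset_flag
  have hagree : AgreeOn (ranksOff (below (n := N) F.rank)) (ψ x⁻¹ Φ₀) Ψ := by
    refine .of_forall_mem fun M hM hMr => ?_
    rcases le_or_gt F.rank (Q.rank M) with hFM | hMF
    · exact hΨ (.inr ⟨hM, hFM⟩)
    · have hMbot : Q.rank M = -1 := by
        by_contra hne
        have hM1 := AbstractPolytope.neg_one_le_rank M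
        have hMi : ((Q.rank M).toNat : ℤ) = Q.rank M := Int.toNat_of_nonneg (by lia)
        have hFN := F.rank_le
        exact hMr ⟨(Q.rank M).toNat, by lia⟩ (hMi.trans_lt hMF) hMi
      rw [eq_of_mem_flag hM (Flag.bot_mem _) (hMbot.trans Q.rank_bot.symm)]
      exact Ψ.bot_mem
  obtain ⟨w, hw, hwΨ⟩ := exists_mem_parabolic_apply_eq hagree
  rw [← map_parabolic_flagSwap hψ] at hw
  obtain ⟨v, hv, rfl⟩ := hw
  refine ⟨x * v⁻¹, (mul_mem_iff (inv_mem (parabolic_mono (fun i hi => hi.ne) hv))).2 hx,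
    fun H hH => ?_⟩
  rw [mul_inv_rev, inv_inv, map_mul, Equiv.Perm.mul_apply, hwΨ]
  exact hΨ (.inl hH)

theorem mem_faceStabilizer_of_agreeOn (hψ : ∀ i, ψ (γ i) = Q.flagSwap i) {k r : ℤ}
    (hfree : ∀ v ∈ parabolic γ (below k), ∀ Φ, ψ v Φ = Φ → v = 1) {v : Γ}
    (hv : v ∈ parabolic γ (below k)) {Φ : Flag Q.Face} (h : AgreeOn {r} (ψ v Φ) Φ) :
    v ∈ faceStabilizer γ r := by
  have hψv : ψ v ∈ parabolic Q.flagSwap (below k) := by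
    rw [← map_parabolic_flagSwap hψ]
    exact Subgroup.mem_map_of_mem ψ hv
  have hagree : AgreeOn (ranksOff (below k ∩ {i | (i : ℤ) ≠ r})) Φ (ψ v Φ) := fun M hM => by
    rcases eq_or_ne (Q.rank M) r with hMr | hMr
    · exact (h M hMr).symm
    · exact (agreeOn_apply hψv Φ M fun i hi hiM => hM i ⟨hi, hiM.trans_ne hMr⟩ hiM).symm
  obtain ⟨w, hw, hwΦ⟩ := exists_mem_parabolic_apply_eq hagree
  rw [← map_parabolic_flagSwap hψ] at hw
  obtain ⟨u, hu, rfl⟩ := hw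
  have huv : u⁻¹ * v = 1 := by
    refine hfree _ (mul_mem (inv_mem (parabolic_mono Set.inter_subset_left hu)) hv) Φ ?_
    rw [map_mul, Equiv.Perm.mul_apply, ← hwΦ, ← Equiv.Perm.mul_apply, ← map_mul, inv_mul_cancel,
      map_one, Equiv.Perm.one_apply]
  rw [← inv_mul_eq_one.1 huv]
  exact parabolic_mono Set.inter_subset_right hu

theorem mem_of_cosetProj_mem (hψ : ∀ i, ψ (γ i) = Q.flagSwap i)
    (hfree : ∀ v ∈ parabolic γ (below F.rank), ∀ Φ, ψ v Φ = Φ → v = 1) (hGF : G ≤ F)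
    (hx : x ∈ F) (h : cosetProj hγ ψ Φ₀ G ∈ ψ x⁻¹ Φ₀) : x ∈ G := by
  obtain ⟨hr, y, hyG, hyF⟩ := hGF
  obtain ⟨a, ha, b, hb, hab⟩ := hγ.exists_mul (fun _ hi => hi) ((mem_iff_of_mem hyF).1 hx)
  obtain rfl : y * a * b = x := by rw [mul_assoc, hab, mul_inv_cancel_left]
  have hb' : b ∈ faceStabilizer γ G.rank := parabolic_mono (fun i hi => (hr.trans_lt hi.2).ne') hb
  have hG : cosetProj hγ ψ Φ₀ G ∈ ψ (y * a)⁻¹ Φ₀ :=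
    (agreeOn_of_inv_mul_mem hψ Φ₀ (by rwa [inv_mul_cancel_left]) _ rank_cosetProj).2 h
  have hay : ψ a (ψ (y * a)⁻¹ Φ₀) = ψ y⁻¹ Φ₀ := by
    rw [← Equiv.Perm.mul_apply, ← map_mul, mul_inv_rev, mul_inv_cancel_left]
  have hagree : AgreeOn {G.rank} (ψ a (ψ (y * a)⁻¹ Φ₀)) (ψ (y * a)⁻¹ Φ₀) := by
    refine .of_forall_mem fun M hM hMr => ?_
    rw [hay] at hM
    rwa [eq_of_mem_flag hM (cosetProj_mem hψ hyG) (hMr.trans rank_cosetProj.symm)]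
  have ha' : a ∈ faceStabilizer γ G.rank :=
    mem_faceStabilizer_of_agreeOn hψ hfree (parabolic_mono Set.inter_subset_right ha) hagree
  exact (mul_mem_iff hb').2 ((mul_mem_iff ha').2 hyG)

theorem nonempty_Icc_orderIso (hψ : ∀ i, ψ (γ i) = Q.flagSwap i) (F : CosetFace hγ)
    (hfree : ∀ v ∈ parabolic γ (below F.rank), ∀ Φ, ψ v Φ = Φ → v = 1) :
    Nonempty (Set.Icc ⊥ F ≃o Set.Icc ⊥ (cosetProj hγ ψ Φ₀ F)) := by
  have hmono := monotone_cosetProj (hγ := hγ) (Φ₀ := Φ₀) hψ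
  let f : Set.Icc ⊥ F → Set.Icc ⊥ (cosetProj hγ ψ Φ₀ F) :=
    fun G => ⟨cosetProj hγ ψ Φ₀ G, bot_le, hmono G.2.2⟩
  have hf (G H) : f G ≤ f H ↔ G ≤ H := by
    refine ⟨fun hGH => ?_, fun hGH => hmono hGH⟩
    obtain ⟨z, hzF, hz⟩ := exists_mem_of_isChain hψ (C := {(f G : Q.Face), (f H : Q.Face)})
      (IsChain.pair hGH) (by rintro _ (rfl | rfl); exacts [(f G).2.2, (f H).2.2])
    exact le_of_mem (mem_of_cosetProj_mem hψ hfree G.2.2 hzF (hz _ (.inl rfl)))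
      (mem_of_cosetProj_mem hψ hfree H.2.2 hzF (hz _ (.inr rfl)))
      (by simpa only [f, rank_cosetProj] using Q.rank_strictMono.monotone hGH)
  refine ⟨RelIso.ofSurjective (OrderEmbedding.ofMapLEIff f hf) fun H => ?_⟩
  obtain ⟨z, hzF, hz⟩ := exists_mem_of_isChain hψ (F := F) (C := {(H : Q.Face)}) (.singleton)
    (by rintro _ rfl; exact H.2.2)
  obtain ⟨G, hzG, hGH⟩ := exists_cosetProj_eq (hγ := hγ) hψ (hz _ rfl)
  have hr : G.rank ≤ F.rank := by
    rw [← rank_cosetProj (ψ := ψ) (Φ₀ := Φ₀), hGH, ← rank_cosetProj (F := F) (ψ := ψ) (Φ₀ := Φ₀)]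
    exact Q.rank_strictMono.monotone H.2.2
  exact ⟨⟨G, bot_le, le_of_mem hzG hzF hr⟩, Subtype.ext hGH⟩

end CosetCovering

namespace AbstractPolytope

theorem exists_isStringCGroup_hom_flagSwap {N : ℕ} {Q : AbstractPolytope.{u} N} {k : ℤ}
    (hk : k ≤ N) (hfree : ∀ w ∈ parabolic Q.flagSwap (below k), ∀ Φ, w Φ = Φ → w = 1) :
    ∃ (Γ : Type u) (_ : Group Γ) (_ : Finite Q.Face → Finite Γ) (γ : Fin N → Γ)
      (ψ : Γ →* Equiv.Perm (Flag Q.Face)), IsStringCGroup γ ∧ (∀ i, ψ (γ i) = Q.flagSwap i) ∧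
        ∀ v ∈ parabolic γ (below k), ∀ Φ, ψ v Φ = Φ → v = 1 := by
  have hbelow : below (n := N) (k.toNat : ℤ) = below k :=
    Set.ext fun i => by simp only [mem_below]; omega
  have hspan : IntersectionOn (spanGen Q.flagSwap) (below (k.toNat : ℤ)) :=
    hbelow ▸ .of_injOn (Subgroup.subtype _) (Subgroup.subtype_injective _).injOn
      (intersectionOn_flagSwap hfree)
  obtain ⟨Γ, _, hfin, γ, φ, hγ, -, hφ, hinj⟩ :=
    (isSggi_spanGen_flagSwap Q).exists_isStringCGroup_hom_injOn (Int.toNat_le.2 hk) hspan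
  rw [hbelow] at hinj
  let ψ := (Subgroup.subtype _).comp φ
  have hψ (i : Fin N) : ψ (γ i) = Q.flagSwap i := congrArg Subtype.val (hφ i)
  refine ⟨Γ, _, fun _ => ?_, γ, ψ, hγ, hψ, fun v hv Φ hΦ => ?_⟩
  · have : Finite (Flag Q.Face) := Finite.of_injective _ SetLike.coe_injective
    exact hfin inferInstance
  · have hψv : ψ v = 1 := by
      refine hfree _ ?_ Φ hΦ
      rw [← map_parabolic_flagSwap hψ]
      exact Subgroup.mem_map_of_mem ψ hv
    exact hinj hv (one_mem _) (Subtype.ext (hψv.trans (congrArg Subtype.val (map_one φ)).symm))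

theorem exists_isRegular_covers_of_free {N : ℕ} {Q : AbstractPolytope.{u} N} {k : ℤ} (hk : k ≤ N)
    (hfree : ∀ w ∈ parabolic Q.flagSwap (below k), ∀ Φ, w Φ = Φ → w = 1) :
    ∃ R : AbstractPolytope.{u} N, (Finite Q.Face → Finite R.Face) ∧ R.IsRegular ∧ R.Covers Q ∧
      ∀ F : R.Face, R.rank F = k →
        ∃ F' : Q.Face, Q.rank F' = k ∧ Nonempty (Set.Icc ⊥ F ≃o Set.Icc ⊥ F') := by
  obtain ⟨Γ, _, hfin, γ, ψ, hγ, hψ, hfreeψ⟩ := exists_isStringCGroup_hom_flagSwap hk hfree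
  obtain ⟨Φ₀⟩ := (inferInstance : Nonempty (Flag Q.Face))
  refine ⟨cosetPolytope hγ, fun hQ => ?_, isRegular_cosetPolytope hγ,
    ⟨_, isCovering_cosetProj (Φ₀ := Φ₀) hγ hψ⟩, ?_⟩
  · have := hfin hQ
    exact inferInstanceAs (Finite (CosetFace hγ.toIsSggi))
  · rintro F rfl
    exact ⟨_, rank_cosetProj, nonempty_Icc_orderIso (Φ₀ := Φ₀) hψ F hfreeψ⟩

theorem covers_refl {n : ℤ} (Q : AbstractPolytope.{u} n) : Q.Covers Q :=
  ⟨id, monotone_id, fun _ => rfl, fun _ Φ Ψ h =>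
    ⟨Φ, Ψ, (Set.image_id _).symm, (Set.image_id _).symm, h⟩⟩

theorem isRegular_of_neg {n : ℤ} (hn : n < 0) (Q : AbstractPolytope.{u} n) : Q.IsRegular := by
  have hbot (F : Q.Face) : F = ⊥ := by
    by_contra hne
    have hlt := Q.rank_strictMono (bot_lt_iff_ne_bot.2 hne)
    have hle := rank_le F
    rw [Q.rank_bot] at hlt
    lia
  refine fun Φ Ψ => ⟨OrderIso.refl _, flag_eq_of_subset fun F _ => ?_⟩
  rw [hbot F]
  exact Ψ.bot_mem

theorem exists_isRegular_covers {n : ℤ} (Q : AbstractPolytope.{u} n) :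
    ∃ R : AbstractPolytope.{u} n, (Finite Q.Face → Finite R.Face) ∧ R.IsRegular ∧ R.Covers Q := by
  rcases lt_or_ge n 0 with hn | hn
  · exact ⟨Q, id, Q.isRegular_of_neg hn, Q.covers_refl⟩
  obtain ⟨N, rfl⟩ := Int.eq_ofNat_of_zero_le hn
  obtain ⟨R, hfin, hreg, hcov, -⟩ := exists_isRegular_covers_of_free (Q := Q) hn
    fun w hw _ _ => by rwa [parabolic_below_zero, Subgroup.mem_bot] at hw
  exact ⟨R, hfin, hreg, hcov⟩

theorem exists_isRegular_covers_of_allFacesIso {n k : ℤ} {Q : AbstractPolytope.{u} n}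
    {K : AbstractPolytope.{v} k} (hK : K.IsRegular) (hQ : Q.AllFacesIso k K) :
    ∃ R : AbstractPolytope.{u} n, (Finite Q.Face → Finite R.Face) ∧ R.IsRegular ∧ R.Covers Q ∧
      R.AllFacesIso k K := by
  rcases lt_or_ge n 0 with hn | hn
  · exact ⟨Q, id, Q.isRegular_of_neg hn, Q.covers_refl, hQ⟩
  by_cases hk : -1 ≤ k ∧ k ≤ n
  · obtain ⟨N, rfl⟩ := Int.eq_ofNat_of_zero_le hn
    obtain ⟨R, hfin, hreg, hcov, hface⟩ := exists_isRegular_covers_of_free hk.2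
      fun w hw Φ => eq_one_of_apply_eq hk.1 hk.2 hK hQ hw
    refine ⟨R, hfin, hreg, hcov, fun F hF => ?_⟩
    obtain ⟨F', hF', ⟨e⟩⟩ := hface F hF
    obtain ⟨e'⟩ := hQ F' hF'
    exact ⟨e.trans e'⟩
  · obtain ⟨R, hfin, hreg, hcov⟩ := Q.exists_isRegular_covers
    exact ⟨R, hfin, hreg, hcov, fun F hF => absurd ⟨hF ▸ neg_one_le_rank F, hF ▸ rank_le F⟩ hk⟩

end AbstractPolytope

theorem IsSggi.exists_isStringCGroup_covers {n : ℕ} {G : Type u} [Group G] {g : Fin n → G}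
    (hg : IsSggi g) : ∃ (G' : Type u) (_ : Group G') (_ : Finite G → Finite G') (g' : Fin n → G'),
      IsStringCGroup g' ∧ SggiCovers g' g := by
  have h0 : IntersectionOn g (below ((0 : ℕ) : ℤ)) := fun I hI _ _ x ⟨hx, _⟩ => by
    have hx' := parabolic_mono hI hx
    rw [Nat.cast_zero, parabolic_below_zero, Subgroup.mem_bot] at hx'
    exact hx' ▸ one_mem _
  obtain ⟨G', _, hfin, g', φ, hg', hφ, hφg, -⟩ := hg.exists_isStringCGroup_hom_injOn n.zero_le h0
  exact ⟨G', _, hfin, g', hg', φ, hφ, hφg⟩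

theorem theorem3p3_general :
    (∀ (n : ℕ) (G : Type u) [Group G] (g : Fin n → G), IsSggi g →
      ∃ (G' : Type u) (_ : Group G') (_ : Finite G → Finite G') (g' : Fin n → G'),
        IsStringCGroup g' ∧ SggiCovers g' g) ∧
    (∀ (n : ℤ) (Q : AbstractPolytope.{u} n),
      (∃ R : AbstractPolytope.{u} n, (Finite Q.Face → Finite R.Face) ∧ R.IsRegular ∧
        R.Covers Q) ∧
      (∀ (k : ℤ) (K : AbstractPolytope.{v} k), K.IsRegular → Q.AllFacesIso k K →
        ∃ R : AbstractPolytope.{u} n, (Finite Q.Face → Finite R.Face) ∧ R.IsRegular ∧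
          R.Covers Q ∧ R.AllFacesIso k K)) :=
  ⟨fun _ _ _ _ hg => hg.exists_isStringCGroup_covers, fun _ Q =>
    ⟨Q.exists_isRegular_covers, fun _ _ => AbstractPolytope.exists_isRegular_covers_of_allFacesIso⟩⟩

theorem theorem3p3 :
    -- (a) every finite sggi is covered by a finite string C-group
    (∀ (n : ℕ) (G : Type u) [Group G] [Finite G] (g : Fin n → G), IsSggi g →
      ∃ (G' : Type u) (_ : Group G') (_ : Finite G') (g' : Fin n → G'),
        IsStringCGroup g' ∧ SggiCovers g' g) ∧
    -- (b) every finite polytope is covered by a finite regular one of the same rank,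
    -- which can be chosen with prescribed regular k-faces if the given polytope has them
    (∀ (n : ℤ) (Q : AbstractPolytope.{u} n), Finite Q.Face →
      (∃ R : AbstractPolytope.{u} n, Finite R.Face ∧ R.IsRegular ∧ R.Covers Q) ∧
      (∀ (k : ℤ) (K : AbstractPolytope.{v} k), K.IsRegular → Q.AllFacesIso k K →
        ∃ R : AbstractPolytope.{u} n, Finite R.Face ∧ R.IsRegular ∧ R.Covers Q ∧
          R.AllFacesIso k K)) := by
  obtain ⟨ha, hb⟩ := theorem3p3_general.{u, v}
  exact ⟨fun n G _ hG g hg => (ha n G g hg).imp fun _ ⟨i, hfin, h⟩ => ⟨i, hfin hG, h⟩,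
    fun n Q hQ => ⟨(hb n Q).1.imp fun _ => .imp_left (· hQ),
      fun k K hK hQK => ((hb n Q).2 k K hK hQK).imp fun _ => .imp_left (· hQ)⟩⟩
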